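/- Let $\mathbb S^k\subset\mathbb R^{k+1}$ be the unit sphere with intrinsic distance $d(x,y)=\arccos(x\cdot y)$ and North pole $N$, let $\varepsilon\in(0,\pi/2)$ and $0<r<\pi/2-\varepsilon$, and put $$\mathcal D_\varepsilon=\{x\in\mathbb S^k: d(x,N)<\pi/2-\varepsilon\},\qquad \overline D_r=\{x\in\mathbb S^k: d(x,N)\le r\}.$$ Let $K(x,y)=g(d(x,y)^2)$, where $g:[0,\infty)\to\mathbb R$ is differentiable with locally Lipschitz derivative. For a curve $\rho=(\rho_t)_{t\ge 0}$ of Borel probability measures on $\mathcal D_\varepsilon$ let $$v[\rho](x,t)=-\int_{\mathcal D_\varepsilon}\nabla_{\mathbb S^k}K_y(x)\,d\rho_t(y),\qquad K_y=K(\cdot,y).$$ A flow map generated by $v[\rho]$ on $\operatorname{supp}(\rho_0)\times[0,\infty)$ is a map $\Psi:\operatorname{supp}(\rho_0)\times[0,\infty)\to\mathcal D_\varepsilon$ with $\Psi^0(x)=x$ and $\frac{d}{dt}\Psi^t(x)=v[\rho](\Psi^t(x),t)$ for all $x\in\operatorname{supp}(\rho_0)$ and $t\ge0$. A global weak solution of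 $\partial_t\rho-\nabla_{\mathbb S^k}\cdot(\rho\,\nabla_{\mathbb S^k}K*\rho)=0$ is a narrowly continuous curve $\rho\in C([0,\infty);\mathcal P(\mathcal D_\varepsilon))$ such that $v[\rho]$ generates a unique flow map $\Psi$ on $\operatorname{supp}(\rho_0)\times[0,\infty)$ and $\rho_t=\Psi^t\#\rho_0$ for all $t\ge0$. Define $G(x,y)=2g'(d(x,y)^2)\,\dfrac{d(x,y)}{\sin d(x,y)}$ for $x\ne y$ in $\mathcal D_\varepsilon$, and $G(x,x)=2g'(0)$. **Theorem (asymptotic consensus in the continuum model).** Suppose that $g'\ge 0$ on $[0,\infty)$, that $g'$ is continuously differentiable on $[0,4r^2]$, that there is $C>0$ with $G(x,y)\ge C$ for all $x,y\in\mathcal D_\varepsilon$, and that $G(x_1,y_1)\ge G(x_2,y_2)$ for all $x_1,y_1,x_2,y_2\in\mathcal D_\varepsilon$ with $d(x_1,y_1)\ge d(x_2,y_2)$. Let $\rho_0$ be a Borel probability measure on $\mathcal D_\varepsilon$ with $\operatorname{supp}(\rho_0)\subset\overline D_r$. Then there is a unique global weak solution $\rho\in C([0,\infty);\mathcal P(\mathcal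 D_\varepsilon))$ starting from $\rho_0$, and there exists $p\in\overline D_r$ such that $$W_1(\rho_t,\delta_p)\to 0\qquad\text{as }t\to\infty,$$ where $W_1$ is the $1$-Wasserstein distance on $\mathcal P(\mathcal D_\varepsilon)$ with cost $d$. -/

import Mathlib

open Set Filter Topology MeasureTheory
open scoped NNReal ENNReal

namespace SphereConsensus

noncomputable section

/-- The ambient Euclidean space `ℝ^(k+1)`. -/
abbrev Amb (k : ℕ) : Type := EuclideanSpace ℝ (Fin (k + 1))

/-- The unit sphere `S^k` in `ℝ^(k+1)`. -/
abbrev Sph (k : ℕ) : Type := Metric.sphere (0 : Amb k) 1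

/-- The North pole `N = (0, …, 0, 1)`. -/
def northPole (k : ℕ) : Sph k :=
  ⟨EuclideanSpace.single (Fin.last k) (1 : ℝ), by simp⟩

/-- The intrinsic (great-circle) distance `d(x, y) = arccos (x · y)` on the sphere. -/
def geoDist {k : ℕ} (x y : Sph k) : ℝ :=
  Real.arccos (inner ℝ (x : Amb k) (y : Amb k))

/-- The open geodesic disk `𝒟_ε = {x ∈ S^k : d(x, N) < π/2 - ε}`, with the topology and the
Borel σ-algebra induced by the sphere. -/
abbrev Disk (k : ℕ) (ε : ℝ) : Type :=
  {x : Sph k // geoDist x (northPole k) < Real.pi / 2 - ε}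

/-- Radial projection `z ↦ z / |z|` onto the sphere (with an arbitrary value at `z = 0`). -/
def toSphere {k : ℕ} (z : Amb k) : Sph k :=
  if h : z = 0 then northPole k
  else ⟨‖z‖⁻¹ • z, by simp [norm_smul, norm_ne_zero_iff.mpr h]⟩

/-- The Riemannian gradient `∇_{S^k} F (x) ∈ T_x S^k ⊂ ℝ^(k+1)` of `F : S^k → ℝ` for the induced
metric.  It is the Euclidean gradient at `x` of the extension `z ↦ F (z / |z|)`: this extension
restricts to `F` on the sphere and is constant along the radial direction, so its Euclidean gradient
at `x` is tangent to the sphere and represents the differential of `F` at `x`. -/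
def sphereGradient {k : ℕ} (F : Sph k → ℝ) (x : Sph k) : Amb k :=
  gradient (fun z : Amb k => F (toSphere z)) (x : Amb k)

/-- The derivative `g'` of a function `g` on `[0, ∞)` (one-sided at `0`). -/
def derivHalf (g : ℝ → ℝ) : ℝ → ℝ :=
  derivWithin g (Ici 0)

/-- The standing assumption on the potential: `g : [0, ∞) → ℝ` is differentiable with locally
Lipschitz derivative (only the values of `g` on `[0, ∞)` matter). -/
def PotentialHyp (g : ℝ → ℝ) : Prop :=
  DifferentiableOn ℝ g (Ici 0) ∧ LocallyLipschitzOn (Ici 0) (derivHalf g)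

/-- The interaction potential `K(x, y) = g (d(x, y)²)`. -/
def potential {k : ℕ} (g : ℝ → ℝ) (x y : Sph k) : ℝ :=
  g (geoDist x y ^ 2)

/-- The velocity field `v[ρ](x, t) = -∫ ∇_{S^k} K_y (x) dρ_t(y)`, where `K_y = K(·, y)`. -/
def velocity {k : ℕ} {ε : ℝ} (g : ℝ → ℝ) (ρ : ℝ≥0 → ProbabilityMeasure (Disk k ε))
    (x : Disk k ε) (t : ℝ≥0) : Amb k :=
  -∫ y : Disk k ε, sphereGradient (fun z : Sph k => potential g z y.1) x.1
    ∂(ρ t : Measure (Disk k ε))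

/-- `Ψ : S × [0, ∞) → 𝒟_ε` is a (global) flow map generated by the time-dependent vector field `X`
and the set `S`: `Ψ^0(x) = x` and `d/dt Ψ^t(x) = X(Ψ^t(x), t)` for `x ∈ S` and `t ≥ 0`. Velocities
are read in `ℝ^(k+1)`, and the time derivative is one-sided at `t = 0`. -/
def IsFlowMap {k : ℕ} {ε : ℝ} (X : Disk k ε → ℝ≥0 → Amb k) (S : Set (Disk k ε))
    (Ψ : S → ℝ≥0 → Disk k ε) : Prop :=
  ∀ x : S, Ψ x 0 = x.1 ∧
    ∀ t : ℝ≥0, HasDerivWithinAt (fun s : ℝ => ((Ψ x s.toNNReal).1 : Amb k))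
      (X (Ψ x t) t) (Ici 0) (t : ℝ)

/-- The push-forward of `μ` through a map `Ψ` defined only on a set `S`. -/
def pushForward {k : ℕ} {ε : ℝ} (μ : Measure (Disk k ε)) (S : Set (Disk k ε))
    (Ψ : S → Disk k ε) : Measure (Disk k ε) :=
  (μ.comap (Subtype.val : S → Disk k ε)).map Ψ

/-- `ρ ∈ C([0, ∞); 𝒫(𝒟_ε))` (narrow topology) is a global weak solution of
`∂_t ρ - ∇·(ρ ∇K * ρ) = 0`: the field `v[ρ]` generates a unique flow map `Ψ` on
`supp(ρ_0) × [0, ∞)`, and `ρ_t = Ψ^t # ρ_0` for all `t ≥ 0`. -/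
def IsGlobalWeakSolution {k : ℕ} {ε : ℝ} (g : ℝ → ℝ)
    (ρ : ℝ≥0 → ProbabilityMeasure (Disk k ε)) : Prop :=
  Continuous ρ ∧
  ∃ Ψ : (ρ 0 : Measure (Disk k ε)).support → ℝ≥0 → Disk k ε,
    IsFlowMap (velocity g ρ) (ρ 0 : Measure (Disk k ε)).support Ψ ∧
    (∀ Φ : (ρ 0 : Measure (Disk k ε)).support → ℝ≥0 → Disk k ε,
      IsFlowMap (velocity g ρ) (ρ 0 : Measure (Disk k ε)).support Φ → Φ = Ψ) ∧
    ∀ t : ℝ≥0, (ρ t : Measure (Disk k ε)) =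
      pushForward (ρ 0 : Measure (Disk k ε)) (ρ 0 : Measure (Disk k ε)).support
        (fun x => Ψ x t)

/-- `G(x, y) = 2 g'(d²) d / sin d` with `d = d(x, y)` for `x ≠ y`, and `G(x, x) = 2 g'(0)`. -/
def interactionG {k : ℕ} (g : ℝ → ℝ) (x y : Sph k) : ℝ :=
  open Classical in
  if x = y then 2 * derivHalf g 0
  else 2 * derivHalf g (geoDist x y ^ 2) * (geoDist x y / Real.sin (geoDist x y))

/-- The intrinsic 1-Wasserstein distance on `𝒫(𝒟_ε)`: the infimum of `∫ d(x, y) dπ(x, y)` over all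
transport plans `π` between `μ` and `ν`. -/
def W1 {k : ℕ} {ε : ℝ} (μ ν : Measure (Disk k ε)) : ℝ≥0∞ :=
  ⨅ π ∈ {π : Measure (Disk k ε × Disk k ε) | π.map Prod.fst = μ ∧ π.map Prod.snd = ν},
    ∫⁻ z, ENNReal.ofReal (geoDist z.1.1 z.2.1) ∂π

end

end SphereConsensus

open SphereConsensus

/-!
On the disk, the gradient of `K_y = g (d(·, y)²)` is `-G(x, y) (y - (x · y) x)`, so that the
velocity is `∫ G(x, y) (y - (x · y) x) dρ(y)`, where `G(x, y)` is a nonnegative function of `x · y`.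
This function is Lipschitz, because both `d²` and `d / sin d` are Lipschitz as functions of `cos d`
as long as `d` stays away from `π`.

**Well-posedness.** Composed with the radial retraction onto the unit ball, the kernel becomes
bounded and globally Lipschitz on the ambient space (`pairVelocity`). A weak solution is then the
same thing as a mean-field flow, in which the particle with label `x` in the support of `ρ₀` moves
with the velocity induced by all the other particles. Such a flow is an integral curve of a bounded
Lipschitz field on the Banach space of bounded continuous maps from the support to the ambient
space, so it exists for all time by the Picard-Lindelöf theorem. A Grönwall lemma for families of
functions coupled through their supremum, `nonpos_of_deriv_le_mul_sup`, shows that the flow stays in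
the disk of radius `r` and that flows and weak solutions are unique.

**Consensus.** Let `c` be the mean position in the ambient space. The defect `1 - |c|²` is the
average of `1 - x · y` over pairs of particles. Since `G` is symmetric, exchanging the particles of
a pair gives `2 c' = ∬ G(x, y) (1 - x · y) (x + y)`. Hence `|c'| ≤ M (1 - |c|²)`, while
`N · c' ≥ C cos r (1 - |c|²)`, because every particle satisfies `x · N ≥ cos r`. The bounded
quantity `N · c` is therefore nondecreasing and controls the length of `c`, so that `c` converges,
and the limit is a unit vector `p`, because otherwise `N · c` would grow linearly
(`exists_tendsto_of_norm_deriv_le`). Finally `W₁(ρ_t, δ_p)` is at most `π / 2` times the mean chord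
from `p`, whose square is at most `2 - 2 c · p`.
-/

namespace SphereConsensus

/-! ### A Grönwall lemma for families of functions -/

/-- A one-sided Grönwall lemma for a family that is coupled through its supremum: if every member
starts nonpositive and, whenever all members are at most `c > 0`, those that are nonnegative have
slope at most `L * c`, then no member ever becomes positive. No regularity in the index is needed:
the bound `M` improves inductively to `η * exp (K * t) + M * (K * t) ^ n / n!`, where `K = L + 1`,
for every `n` and every `η > 0`. -/
theorem nonpos_of_deriv_le_mul_sup {ι : Type*} {f f' : ι → ℝ → ℝ} {L M : ℝ} (hL : 0 ≤ L)
    (hderiv : ∀ i t, 0 ≤ t → HasDerivWithinAt (f i) (f' i t) (Ici 0) t)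
    (h0 : ∀ i, f i 0 ≤ 0) (hM : ∀ i t, 0 ≤ t → f i t ≤ M)
    (hbound : ∀ t, 0 ≤ t → ∀ c, 0 < c → (∀ j, f j t ≤ c) → ∀ i, 0 ≤ f i t → f' i t ≤ L * c)
    (i : ι) {t : ℝ} (ht : 0 ≤ t) : f i t ≤ 0 := by
  set K := L + 1 with hK
  have hKpos : 0 < K := by linarith
  set M' := max M 0
  have hM' : 0 ≤ M' := le_max_right _ _
  have key : ∀ η : ℝ, 0 < η → ∀ n : ℕ, ∀ i t, 0 ≤ t →
      f i t ≤ η * Real.exp (K * t) + M' * ((K * t) ^ n / n.factorial) := by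
    intro η hη n
    induction n with
    | zero =>
      intro i t ht
      have h1 := hM i t ht
      have h2 : M ≤ M' := le_max_left _ _
      have h3 := mul_pos hη (Real.exp_pos (K * t))
      simp only [pow_zero, Nat.factorial_zero, Nat.cast_one, div_one, mul_one]
      linarith
    | succ n ih =>
      intro i t ht
      have hB : ∀ x : ℝ, HasDerivAt
          (fun x => η * Real.exp (K * x) + M' * ((K * x) ^ (n + 1) / (n + 1).factorial))
          (K * (η * Real.exp (K * x) + M' * ((K * x) ^ n / n.factorial))) x := by
        intro x
        have h1 : HasDerivAt (fun x => K * x) K x := by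
          simpa using (hasDerivAt_id x).const_mul K
        have h2 := (h1.exp.const_mul η).add
          (((h1.pow (n + 1)).div_const ((n + 1).factorial : ℝ)).const_mul M')
        convert! h2 using 1
        have : (n.factorial : ℝ) ≠ 0 := by positivity
        rw [Nat.factorial_succ]
        push_cast
        field_simp
      refine image_le_of_deriv_right_lt_deriv_boundary (f := f i) (f' := f' i) (a := 0) (b := t)
        (fun x hx => ((hderiv i x hx.1).continuousWithinAt.mono Icc_subset_Ici_self))
        (fun x hx => (hderiv i x hx.1).mono (Ici_subset_Ici.2 hx.1)) ?_ hB ?_ ⟨ht, le_rfl⟩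
      · have := h0 i
        simp only [mul_zero, Real.exp_zero, mul_one, ne_eq, Nat.add_eq_zero_iff, one_ne_zero,
          and_false, not_false_eq_true, zero_pow, zero_div, add_zero]
        linarith
      · intro x hx hfx
        have hx0 := hx.1
        have hpos : 0 < η * Real.exp (K * x) + M' * ((K * x) ^ n / n.factorial) := by positivity
        have h1 : 0 ≤ f i x := by rw [hfx]; positivity
        have h2 := hbound x hx0 _ hpos (fun j => ih j x hx0) i h1
        refine h2.trans_lt ?_
        exact mul_lt_mul_of_pos_right (by linarith) hpos
  have key2 : ∀ η : ℝ, 0 < η → f i t ≤ η * Real.exp (K * t) := by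
    intro η hη
    have h1 := ((FloorSemiring.tendsto_pow_div_factorial_atTop (K * t)).const_mul M').const_add
      (η * Real.exp (K * t))
    rw [mul_zero, add_zero] at h1
    exact ge_of_tendsto' h1 fun n => key η hη n i t ht
  refine le_of_forall_pos_le_add fun δ hδ => ?_
  have := key2 (δ / Real.exp (K * t)) (by positivity)
  rwa [div_mul_cancel₀ _ (Real.exp_pos _).ne', ← zero_add δ] at this

/-- The vector-valued counterpart, applied to the squared norms. -/
theorem eq_zero_of_norm_deriv_le_mul_sup {ι E : Type*} [NormedAddCommGroup E]
    [InnerProductSpace ℝ E] {u u' : ι → ℝ → E} {L M : ℝ} (hL : 0 ≤ L)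
    (hderiv : ∀ i t, 0 ≤ t → HasDerivWithinAt (u i) (u' i t) (Ici 0) t)
    (h0 : ∀ i, u i 0 = 0) (hM : ∀ i t, 0 ≤ t → ‖u i t‖ ≤ M)
    (hbound : ∀ t, 0 ≤ t → ∀ c, 0 < c → (∀ j, ‖u j t‖ ≤ c) → ∀ i, ‖u' i t‖ ≤ L * c)
    (i : ι) {t : ℝ} (ht : 0 ≤ t) : u i t = 0 := by
  have h := nonpos_of_deriv_le_mul_sup (f := fun i t => ‖u i t‖ ^ 2)
    (f' := fun i t => 2 * inner ℝ (u i t) (u' i t)) (L := 2 * L) (M := M ^ 2) (by positivity)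
    (fun i t ht => (hderiv i t ht).norm_sq) (fun i => by simp [h0 i])
    (fun i t ht => by have := hM i t ht; gcongr) ?_ i ht
  · have h1 : ‖u i t‖ ^ 2 = 0 := le_antisymm h (by positivity)
    simpa using h1
  · intro t ht c hc hj i _
    have hs : ∀ j, ‖u j t‖ ≤ √c := fun j => Real.le_sqrt_of_sq_le (hj j)
    have h1 := hbound t ht (√c) (Real.sqrt_pos.2 hc) hs i
    have h2 : inner ℝ (u i t) (u' i t) ≤ √c * (L * √c) :=
      (real_inner_le_norm _ _).trans
        (mul_le_mul (hs i) h1 (norm_nonneg _) (Real.sqrt_nonneg _))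
    have h3 := Real.mul_self_sqrt hc.le
    calc 2 * inner ℝ (u i t) (u' i t) ≤ 2 * (√c * (L * √c)) := by gcongr
      _ = 2 * L * (√c * √c) := by ring
      _ = 2 * L * c := by rw [h3]

/-! ### The interaction kernel in the ambient space -/

section Kernel

variable {E : Type*} [NormedAddCommGroup E] [InnerProductSpace ℝ E]

/-- The radial retraction of a Euclidean space onto its closed unit ball. -/
noncomputable def ballRetraction (x : E) : E := (max 1 ‖x‖)⁻¹ • x

theorem ballRetraction_of_norm_le_one {x : E} (hx : ‖x‖ ≤ 1) : ballRetraction x = x := by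
  simp [ballRetraction, max_eq_left hx]

theorem norm_ballRetraction_le (x : E) : ‖ballRetraction x‖ ≤ 1 := by
  have h : 0 < max 1 ‖x‖ := lt_max_of_lt_left one_pos
  rw [ballRetraction, norm_smul, norm_inv, Real.norm_of_nonneg h.le, inv_mul_le_one₀ h]
  exact le_max_right _ _

theorem norm_ballRetraction_sub_le (x y : E) :
    ‖ballRetraction x - ballRetraction y‖ ≤ 2 * ‖x - y‖ := by
  unfold ballRetraction
  set a := max 1 ‖x‖ with ha
  set b := max 1 ‖y‖ with hb
  have ha1 : 1 ≤ a := le_max_left _ _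
  have hb1 : 1 ≤ b := le_max_left _ _
  have hby : ‖y‖ ≤ b := le_max_right _ _
  have hab : |b - a| ≤ ‖x - y‖ := by
    have h1 := abs_max_sub_max_le_abs ‖y‖ ‖x‖ 1
    rw [max_comm _ (1 : ℝ), max_comm _ (1 : ℝ)] at h1
    refine h1.trans ?_
    rw [norm_sub_rev]
    exact abs_norm_sub_norm_le y x
  have hne : a ≠ 0 := by positivity
  have hne' : b ≠ 0 := by positivity
  have hdec : a⁻¹ • x - b⁻¹ • y = a⁻¹ • (x - y) + (a⁻¹ * (b - a)) • (b⁻¹ • y) := by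
    rw [smul_sub, smul_smul]
    have : a⁻¹ * (b - a) * b⁻¹ = a⁻¹ - b⁻¹ := by field_simp
    rw [this, sub_smul]
    abel
  have ha' : ‖a⁻¹‖ ≤ 1 := by
    rw [norm_inv, Real.norm_of_nonneg (by positivity)]
    exact inv_le_one_of_one_le₀ ha1
  have hy : ‖b⁻¹ • y‖ ≤ 1 := norm_ballRetraction_le y
  rw [hdec]
  calc _ ≤ ‖a⁻¹ • (x - y)‖ + ‖(a⁻¹ * (b - a)) • (b⁻¹ • y)‖ := norm_add_le _ _
    _ = ‖a⁻¹‖ * ‖x - y‖ + ‖a⁻¹‖ * |b - a| * ‖b⁻¹ • y‖ := by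
      rw [norm_smul, norm_smul _ (b⁻¹ • y), norm_mul, Real.norm_eq_abs (b - a)]
    _ ≤ 1 * ‖x - y‖ + 1 * ‖x - y‖ * 1 := by gcongr
    _ = 2 * ‖x - y‖ := by ring

/-- The coupling strengths, functions of `s = x · y`, that are admitted in the abstract mean-field
equation: nonnegative, bounded by `M` and Lipschitz with constant `L`. -/
structure IsCoupling (φ : ℝ → ℝ) (M L : ℝ) : Prop where
  nonneg : ∀ s, 0 ≤ φ s
  le : ∀ s, φ s ≤ M
  lipschitz : ∀ s t, |φ s - φ t| ≤ L * |s - t|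

namespace IsCoupling

variable {φ : ℝ → ℝ} {M L : ℝ}

theorem bound_nonneg (h : IsCoupling φ M L) : 0 ≤ M := (h.nonneg 0).trans (h.le 0)

theorem lipschitz_nonneg (h : IsCoupling φ M L) : 0 ≤ L := by
  simpa using (abs_nonneg _).trans (h.lipschitz 1 0)

end IsCoupling

/-- The velocity that a particle at `y` induces at `x`, namely `φ (x · y) (y - (x · y) x)` for unit
vectors `x` and `y`. Off the unit ball it is extended through the radial retraction, which makes it
bounded and globally Lipschitz while keeping it tangent to the sphere along the sphere. -/
noncomputable def pairVelocity (φ : ℝ → ℝ) (x y : E) : E :=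
  φ (inner ℝ (ballRetraction x) (ballRetraction y)) •
    (ballRetraction y - (inner ℝ (ballRetraction x) (ballRetraction y) : ℝ) • ballRetraction x)

theorem pairVelocity_of_norm_eq_one (φ : ℝ → ℝ) {x y : E} (hx : ‖x‖ = 1) (hy : ‖y‖ = 1) :
    pairVelocity φ x y = φ (inner ℝ x y) • (y - (inner ℝ x y : ℝ) • x) := by
  rw [pairVelocity, ballRetraction_of_norm_le_one hx.le, ballRetraction_of_norm_le_one hy.le]

theorem abs_inner_le_one {a b : E} (ha : ‖a‖ ≤ 1) (hb : ‖b‖ ≤ 1) : |inner ℝ a b| ≤ 1 :=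
  (abs_real_inner_le_norm a b).trans (mul_le_one₀ ha (norm_nonneg _) hb)

theorem norm_sub_inner_smul_le {a b : E} (ha : ‖a‖ ≤ 1) (hb : ‖b‖ ≤ 1) :
    ‖b - (inner ℝ a b : ℝ) • a‖ ≤ 2 := by
  have h := abs_inner_le_one ha hb
  calc _ ≤ ‖b‖ + ‖(inner ℝ a b : ℝ) • a‖ := norm_sub_le _ _
    _ = ‖b‖ + |inner ℝ a b| * ‖a‖ := by rw [norm_smul, Real.norm_eq_abs]
    _ ≤ 1 + 1 * 1 := by gcongr
    _ = 2 := by norm_num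

variable {φ : ℝ → ℝ} {M L : ℝ}

theorem norm_pairVelocity_le (h : IsCoupling φ M L) (x y : E) : ‖pairVelocity φ x y‖ ≤ 2 * M := by
  rw [pairVelocity, norm_smul, Real.norm_of_nonneg (h.nonneg _), mul_comm]
  exact mul_le_mul (norm_sub_inner_smul_le (norm_ballRetraction_le x) (norm_ballRetraction_le y))
    (h.le _) (h.nonneg _) (by norm_num)

theorem norm_pairVelocity_sub_le (h : IsCoupling φ M L) (x y x' y' : E) :
    ‖pairVelocity φ x y - pairVelocity φ x' y'‖ ≤
      4 * (L + M) * (‖x - x'‖ + ‖y - y'‖) := by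
  have hx := norm_ballRetraction_sub_le x x'
  have hy := norm_ballRetraction_sub_le y y'
  have ha := norm_ballRetraction_le x
  have hb := norm_ballRetraction_le y
  have ha' := norm_ballRetraction_le x'
  have hb' := norm_ballRetraction_le y'
  unfold pairVelocity
  set a := ballRetraction x
  set b := ballRetraction y
  set a' := ballRetraction x'
  set b' := ballRetraction y'
  set s : ℝ := inner ℝ a b with hs
  set s' : ℝ := inner ℝ a' b' with hs'
  have hM := h.bound_nonneg
  have hL := h.lipschitz_nonneg
  have hss : |s - s'| ≤ ‖a - a'‖ + ‖b - b'‖ := by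
    have : s - s' = inner ℝ (a - a') b + inner ℝ a' (b - b') := by
      rw [hs, hs', inner_sub_left, inner_sub_right]; ring
    rw [this]
    calc _ ≤ |inner ℝ (a - a') b| + |inner ℝ a' (b - b')| := abs_add_le _ _
      _ ≤ ‖a - a'‖ * ‖b‖ + ‖a'‖ * ‖b - b'‖ :=
        add_le_add (abs_real_inner_le_norm _ _) (abs_real_inner_le_norm _ _)
      _ ≤ ‖a - a'‖ * 1 + 1 * ‖b - b'‖ := by gcongr
      _ = _ := by ring
  have hs1 : |s'| ≤ 1 := abs_inner_le_one ha' hb'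
  have hw : ‖(b - s • a) - (b' - s' • a')‖ ≤ 2 * (‖a - a'‖ + ‖b - b'‖) := by
    have : (b - s • a) - (b' - s' • a') = (b - b') - (s - s') • a - s' • (a - a') := by
      rw [sub_smul, smul_sub]; abel
    rw [this]
    calc _ ≤ ‖b - b'‖ + ‖(s - s') • a‖ + ‖s' • (a - a')‖ :=
          (norm_sub_le _ _).trans (add_le_add_left (norm_sub_le _ _) _)
      _ = ‖b - b'‖ + |s - s'| * ‖a‖ + |s'| * ‖a - a'‖ := by
          rw [norm_smul, norm_smul, Real.norm_eq_abs, Real.norm_eq_abs]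
      _ ≤ ‖b - b'‖ + (‖a - a'‖ + ‖b - b'‖) * 1 + 1 * ‖a - a'‖ := by gcongr
      _ = _ := by ring
  have hdec : φ s • (b - s • a) - φ s' • (b' - s' • a') =
      (φ s - φ s') • (b - s • a) + φ s' • ((b - s • a) - (b' - s' • a')) := by
    rw [sub_smul, smul_sub (φ s') (b - s • a)]; abel
  rw [hdec]
  calc _ ≤ ‖(φ s - φ s') • (b - s • a)‖ + ‖φ s' • ((b - s • a) - (b' - s' • a'))‖ :=
        norm_add_le _ _
    _ = |φ s - φ s'| * ‖b - s • a‖ + φ s' * ‖(b - s • a) - (b' - s' • a')‖ := by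
        rw [norm_smul, norm_smul, Real.norm_eq_abs, Real.norm_of_nonneg (h.nonneg s')]
    _ ≤ (L * (‖a - a'‖ + ‖b - b'‖)) * 2 + M * (2 * (‖a - a'‖ + ‖b - b'‖)) := by
        gcongr
        · exact (h.lipschitz s s').trans (by gcongr)
        · exact norm_sub_inner_smul_le ha hb
        · exact h.le s'
    _ = 2 * (L + M) * (‖a - a'‖ + ‖b - b'‖) := by ring
    _ ≤ 2 * (L + M) * (2 * ‖x - x'‖ + 2 * ‖y - y'‖) := by gcongr
    _ = _ := by ring

theorem continuous_pairVelocity (h : IsCoupling φ M L) :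
    Continuous fun p : E × E => pairVelocity φ p.1 p.2 := by
  have hLM : 0 ≤ 4 * (L + M) * 2 := by
    have := h.bound_nonneg; have := h.lipschitz_nonneg; positivity
  refine (LipschitzWith.of_dist_le_mul (K := ⟨_, hLM⟩) fun p q => ?_).continuous
  rw [dist_eq_norm, dist_eq_norm]
  have h1 := norm_pairVelocity_sub_le h p.1 p.2 q.1 q.2
  have h2 : ‖p.1 - q.1‖ ≤ ‖p - q‖ := norm_fst_le (p - q)
  have h3 : ‖p.2 - q.2‖ ≤ ‖p - q‖ := norm_snd_le (p - q)
  have := h.bound_nonneg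
  have := h.lipschitz_nonneg
  refine h1.trans ?_
  change _ ≤ 4 * (L + M) * 2 * ‖p - q‖
  calc _ ≤ 4 * (L + M) * (‖p - q‖ + ‖p - q‖) := by gcongr
    _ = _ := by ring

end Kernel

/-! ### The mean-field equation as an ODE in a space of bounded maps -/

/-- A bounded, globally Lipschitz autonomous vector field on a Banach space has forward integral
curves for all time. -/
theorem exists_forward_integralCurve {X : Type*} [NormedAddCommGroup X] [NormedSpace ℝ X]
    [CompleteSpace X] {F : X → X} {K B : ℝ≥0} (hF : LipschitzWith K F) (hB : ∀ x, ‖F x‖ ≤ B)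
    (x₀ : X) :
    ∃ α : ℝ → X, α 0 = x₀ ∧ ∀ t, 0 ≤ t → HasDerivWithinAt α (F (α t)) (Ici 0) t := by
  have hloc : ∀ n : ℕ, ∃ α : ℝ → X, α 0 = x₀ ∧
      ∀ t ∈ Icc (0 : ℝ) n, HasDerivWithinAt α (F (α t)) (Icc (0 : ℝ) n) t := by
    intro n
    have hPL : IsPicardLindelof (fun _ => F) (tmin := 0) (tmax := n)
        ⟨0, le_rfl, Nat.cast_nonneg n⟩ x₀ (B * n) 0 B K :=
      IsPicardLindelof.of_time_independent (fun x _ => hB x) (hF.lipschitzOnWith) (by simp)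
    exact hPL.exists_eq_forall_mem_Icc_hasDerivWithinAt₀
  choose α h0 hα using hloc
  -- Solutions on different intervals agree wherever both are defined.
  have heq : ∀ m n : ℕ, ∀ s : ℝ, 0 ≤ s → s ≤ m → s ≤ n → α m s = α n s := by
    intro m n s hs hm hn
    have hder : ∀ k : ℕ, s ≤ k → ∀ t ∈ Ico 0 s,
        HasDerivWithinAt (α k) (F (α k t)) (Ici t) t := by
      intro k hk t ht
      refine (hα k t ⟨ht.1, ht.2.le.trans hk⟩).mono_of_mem_nhdsWithin ?_
      exact mem_of_superset (Icc_mem_nhdsGE (ht.2.trans_le hk)) (Icc_subset_Icc_left ht.1)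
    have hcont : ∀ k : ℕ, s ≤ k → ContinuousOn (α k) (Icc 0 s) := fun k hk t ht =>
      (hα k t ⟨ht.1, ht.2.trans hk⟩).continuousWithinAt.mono (Icc_subset_Icc_right hk)
    exact ODE_solution_unique (v := fun _ => F) (K := K) (fun _ => hF) (hcont m hm) (hder m hm)
      (hcont n hn) (hder n hn) (by rw [h0, h0]) ⟨hs, le_rfl⟩
  refine ⟨fun t => α (⌈t⌉₊ + 1) t, h0 _, fun t ht => ?_⟩
  set N := ⌈t⌉₊ + 1 with hN
  have htN : t < (N : ℝ) := by
    have := Nat.le_ceil t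
    rw [hN]; push_cast; linarith
  have h1 : HasDerivWithinAt (α N) (F (α N t)) (Ici 0) t := by
    refine (hα N t ⟨ht, htN.le⟩).mono_of_mem_nhdsWithin ?_
    rw [← Ici_inter_Iic]
    exact inter_mem self_mem_nhdsWithin (mem_nhdsWithin_of_mem_nhds (Iic_mem_nhds htN))
  refine h1.congr_of_eventuallyEq ?_ rfl
  filter_upwards [self_mem_nhdsWithin, mem_nhdsWithin_of_mem_nhds (Iio_mem_nhds htN)] with s hs hs'
  refine heq _ _ s hs ?_ (le_of_lt hs')
  have := Nat.le_ceil s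
  push_cast; linarith

section MeanField

open BoundedContinuousFunction

/-- The coordinate curves of a curve of bounded functions are differentiable along with it. -/
theorem hasDerivWithinAt_bcf_apply {S E : Type*} [TopologicalSpace S] [NormedAddCommGroup E]
    [NormedSpace ℝ E] {α : ℝ → S →ᵇ E} {α' : S →ᵇ E} {s : Set ℝ} {t : ℝ}
    (hα : HasDerivWithinAt α α' s t) (x : S) :
    HasDerivWithinAt (fun τ => α τ x) (α' x) s t :=
  (BoundedContinuousFunction.evalCLM ℝ x : (S →ᵇ E) →L[ℝ] E).hasFDerivAt.comp_hasDerivWithinAt t hα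

variable {S E : Type*} [MeasurableSpace S] {μ : Measure S} [IsProbabilityMeasure μ]
  [NormedAddCommGroup E] [InnerProductSpace ℝ E] {φ : ℝ → ℝ} {M L : ℝ}

/-- The velocity at `z` induced by particles located at `u y`, where the label `y` is distributed
according to `μ`. -/
noncomputable def meanVelocity (φ : ℝ → ℝ) (μ : Measure S) (u : S → E) (z : E) : E :=
  ∫ y, pairVelocity φ z (u y) ∂μ

theorem integrable_pairVelocity (h : IsCoupling φ M L) {u : S → E}
    (hu : AEStronglyMeasurable u μ) (z : E) :
    Integrable (fun y => pairVelocity φ z (u y)) μ := by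
  have hc : Continuous fun w : E => pairVelocity φ z w :=
    (continuous_pairVelocity h).comp (continuous_const.prodMk continuous_id)
  exact Integrable.of_bound (hc.comp_aestronglyMeasurable hu) (2 * M)
    (Eventually.of_forall fun y => norm_pairVelocity_le h z (u y))

theorem norm_meanVelocity_le (h : IsCoupling φ M L) (u : S → E) (z : E) :
    ‖meanVelocity φ μ u z‖ ≤ 2 * M := by
  simpa [meanVelocity] using norm_integral_le_of_norm_le_const (μ := μ) (C := 2 * M)
    (Eventually.of_forall fun y => norm_pairVelocity_le h z (u y))

theorem norm_meanVelocity_sub_le (h : IsCoupling φ M L) {u v : S → E}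
    (hu : AEStronglyMeasurable u μ) (hv : AEStronglyMeasurable v μ) {c : ℝ}
    (hc : ∀ y, ‖u y - v y‖ ≤ c) (z w : E) :
    ‖meanVelocity φ μ u z - meanVelocity φ μ v w‖ ≤ 4 * (L + M) * (‖z - w‖ + c) := by
  rw [meanVelocity, meanVelocity,
    ← integral_sub (integrable_pairVelocity h hu z) (integrable_pairVelocity h hv w)]
  have h1 := h.bound_nonneg
  have h2 := h.lipschitz_nonneg
  have hb : ∀ y, ‖pairVelocity φ z (u y) - pairVelocity φ w (v y)‖ ≤
      4 * (L + M) * (‖z - w‖ + c) := fun y =>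
    (norm_pairVelocity_sub_le h _ _ _ _).trans (by gcongr; exact hc y)
  simpa using norm_integral_le_of_norm_le_const (μ := μ) (Eventually.of_forall hb)

theorem continuous_meanVelocity (h : IsCoupling φ M L) {u : S → E}
    (hu : AEStronglyMeasurable u μ) : Continuous (meanVelocity φ μ u) := by
  have hLM : 0 ≤ 4 * (L + M) := by
    have := h.bound_nonneg; have := h.lipschitz_nonneg; positivity
  refine (LipschitzWith.of_dist_le_mul (K := ⟨_, hLM⟩) fun z w => ?_).continuous
  rw [dist_eq_norm, dist_eq_norm]
  have := norm_meanVelocity_sub_le h hu hu (c := 0) (fun y => by simp) z w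
  rwa [add_zero] at this

variable [TopologicalSpace S] [OpensMeasurableSpace S] [SecondCountableTopology E]

/-- The vector field on bounded continuous configurations `S → E` in which the particle with label
`x` moves with the mean velocity at its position. -/
noncomputable def meanField (h : IsCoupling φ M L) (μ : Measure S) [IsProbabilityMeasure μ]
    (u : S →ᵇ E) : S →ᵇ E :=
  BoundedContinuousFunction.ofNormedAddCommGroup (fun x => meanVelocity φ μ u (u x))
    ((continuous_meanVelocity h u.continuous.aestronglyMeasurable).comp u.continuous) (2 * M)
    (fun x => norm_meanVelocity_le h u (u x))

@[simp]
theorem meanField_apply (h : IsCoupling φ M L) (u : S →ᵇ E) (x : S) :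
    meanField h μ u x = meanVelocity φ μ u (u x) := rfl

theorem exists_meanField_flow [CompleteSpace E] (h : IsCoupling φ M L) (u₀ : S →ᵇ E) :
    ∃ α : ℝ → S →ᵇ E, α 0 = u₀ ∧
      ∀ t, 0 ≤ t → HasDerivWithinAt α (meanField h μ (α t)) (Ici 0) t := by
  have h1 := h.bound_nonneg
  have h2 := h.lipschitz_nonneg
  have hK : 0 ≤ 4 * (L + M) * 2 := by positivity
  have hB : 0 ≤ 2 * M := by positivity
  refine exists_forward_integralCurve (K := ⟨_, hK⟩) (B := ⟨_, hB⟩)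
    (LipschitzWith.of_dist_le_mul fun u v => ?_) (fun u => ?_) u₀
  · rw [dist_eq_norm, dist_eq_norm]
    change _ ≤ 4 * (L + M) * 2 * ‖u - v‖
    refine (BoundedContinuousFunction.norm_le (by positivity)).2 fun x => ?_
    have hc : ∀ y, ‖u y - v y‖ ≤ ‖u - v‖ := fun y => (u - v).norm_coe_le_norm y
    have := norm_meanVelocity_sub_le (μ := μ) h u.continuous.aestronglyMeasurable
      v.continuous.aestronglyMeasurable hc (u x) (v x)
    simp only [BoundedContinuousFunction.coe_sub, Pi.sub_apply, meanField_apply]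
    refine this.trans ?_
    calc _ ≤ 4 * (L + M) * (‖u - v‖ + ‖u - v‖) := by gcongr; exact hc x
      _ = _ := by ring
  · exact BoundedContinuousFunction.norm_ofNormedAddCommGroup_le _ hB _

end MeanField

/-! ### Invariance of the sphere and of spherical caps, and uniqueness -/

section Invariance

variable {S E : Type*} [MeasurableSpace S] {μ : Measure S} [IsProbabilityMeasure μ]
  [NormedAddCommGroup E] [InnerProductSpace ℝ E] {φ : ℝ → ℝ} {M L : ℝ}

/-- The extended kernel leaves the unit sphere invariant: its radial component is controlled by the
distance to the sphere (and vanishes outside the unit ball). -/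
theorem abs_inner_pairVelocity_le (h : IsCoupling φ M L) (x y : E) :
    |inner ℝ x (pairVelocity φ x y)| ≤ M * |‖x‖ ^ 2 - 1| := by
  have hb := norm_ballRetraction_le y
  unfold pairVelocity
  set b := ballRetraction y
  rcases le_total ‖x‖ 1 with hx | hx
  · rw [ballRetraction_of_norm_le_one hx, inner_smul_right, inner_sub_right, inner_smul_right,
      real_inner_self_eq_norm_sq]
    have h1 : |inner ℝ x b| ≤ 1 := abs_inner_le_one hx hb
    have h2 : inner ℝ x b - inner ℝ x b * ‖x‖ ^ 2 = - (inner ℝ x b * (‖x‖ ^ 2 - 1)) := by ring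
    rw [h2, abs_mul, abs_neg, abs_mul, abs_of_nonneg (h.nonneg _)]
    have := h.bound_nonneg
    calc _ ≤ M * (1 * |‖x‖ ^ 2 - 1|) := by gcongr; exact h.le _
      _ = _ := by ring
  · have hx0 : ‖x‖ ≠ 0 := by positivity
    have hR : ballRetraction x = ‖x‖⁻¹ • x := by rw [ballRetraction, max_eq_right hx]
    have : inner ℝ x (b - (inner ℝ (ballRetraction x) b : ℝ) • ballRetraction x) = 0 := by
      rw [hR, inner_sub_right, inner_smul_right, inner_smul_right, inner_smul_left,
        real_inner_self_eq_norm_sq]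
      simp only [conj_trivial]
      field_simp
      ring
    rw [inner_smul_right, this, mul_zero, abs_zero]
    exact mul_nonneg h.bound_nonneg (abs_nonneg _)

theorem inner_meanVelocity [CompleteSpace E] (h : IsCoupling φ M L) {u : S → E}
    (hu : AEStronglyMeasurable u μ) (e z : E) :
    inner ℝ e (meanVelocity φ μ u z) = ∫ y, inner ℝ e (pairVelocity φ z (u y)) ∂μ :=
  (integral_inner (integrable_pairVelocity h hu z) e).symm

/-- A configuration that moves with its own mean velocity: `u x t` is the position at time `t` of
the particle with label `x`. -/
structure IsMeanFieldFlow (φ : ℝ → ℝ) (μ : Measure S) (u : S → ℝ → E) : Prop where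
  aestronglyMeasurable : ∀ t, 0 ≤ t → AEStronglyMeasurable (fun y => u y t) μ
  hasDerivWithinAt : ∀ x t, 0 ≤ t →
    HasDerivWithinAt (u x) (meanVelocity φ μ (fun y => u y t) (u x t)) (Ici 0) t

variable [CompleteSpace E] {u : S → ℝ → E}

theorem IsMeanFieldFlow.norm_eq_one (hu : IsMeanFieldFlow φ μ u) (h : IsCoupling φ M L) {x : S}
    (hx : ‖u x 0‖ = 1) {t : ℝ} (ht : 0 ≤ t) : ‖u x t‖ = 1 := by
  have hd : ∀ s, 0 ≤ s → HasDerivWithinAt (fun s => ‖u x s‖ ^ 2 - 1)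
      (2 * inner ℝ (u x s) (meanVelocity φ μ (fun y => u y s) (u x s))) (Ici 0) s :=
    fun s hs => (hu.hasDerivWithinAt x s hs).norm_sq.sub_const 1
  have h0 : ‖u x t‖ ^ 2 - 1 = 0 := by
    refine eq_zero_of_abs_deriv_le_mul_abs_self_of_eq_zero_right (K := 2 * M) (a := 0) (b := t)
      (f := fun s => ‖u x s‖ ^ 2 - 1)
      (fun s hs => (hd s hs.1).continuousWithinAt.mono Icc_subset_Ici_self)
      (fun s hs => (hd s hs.1).mono (Ici_subset_Ici.2 hs.1)) (by simp [hx]) ?_ t ⟨ht, le_rfl⟩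
    intro s hs
    rw [inner_meanVelocity h (hu.aestronglyMeasurable s hs.1), norm_mul, Real.norm_ofNat, mul_assoc]
    gcongr
    have hb : ∀ y, ‖(inner ℝ (u x s) (pairVelocity φ (u x s) (u y s)) : ℝ)‖ ≤
        M * ‖‖u x s‖ ^ 2 - 1‖ := fun y => abs_inner_pairVelocity_le h (u x s) (u y s)
    simpa using norm_integral_le_of_norm_le_const (μ := μ) (Eventually.of_forall hb)
  have h1 : ‖u x t‖ ^ 2 = 1 := by linarith
  exact (pow_eq_one_iff_of_nonneg (norm_nonneg _) two_ne_zero).1 h1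

/-- The cap `{x · e ≥ a}`, with `a ≥ 0`, is invariant: a particle on its boundary is attracted by
particles of the cap only. -/
theorem IsMeanFieldFlow.le_inner (hu : IsMeanFieldFlow φ μ u) (h : IsCoupling φ M L)
    (hx : ∀ x, ‖u x 0‖ = 1) {e : E} (he : ‖e‖ = 1) {a : ℝ} (ha : 0 ≤ a)
    (ha0 : ∀ x, a ≤ inner ℝ e (u x 0)) (x : S) {t : ℝ} (ht : 0 ≤ t) : a ≤ inner ℝ e (u x t) := by
  have hM := h.bound_nonneg
  have hn : ∀ x t, 0 ≤ t → ‖u x t‖ = 1 := fun x t ht => hu.norm_eq_one h (hx x) ht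
  have key := nonpos_of_deriv_le_mul_sup (f := fun x t => a - inner ℝ e (u x t))
    (f' := fun x t => -inner ℝ e (meanVelocity φ μ (fun y => u y t) (u x t)))
    (L := 2 * M) (M := a + 1) (by positivity) ?_ ?_ ?_ ?_ x ht
  · linarith
  · intro x t ht
    have h1 := (innerSL ℝ e).hasFDerivAt.comp_hasDerivWithinAt t (hu.hasDerivWithinAt x t ht)
    exact h1.const_sub a
  · intro x
    have := ha0 x
    linarith
  · intro x t ht
    have := abs_le.1 (abs_inner_le_one he.le (hn x t ht).le)
    linarith
  · intro t ht c hc hall x hx0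
    have hlow : ∀ y, -(2 * M * c) ≤ inner ℝ e (pairVelocity φ (u x t) (u y t)) := by
      intro y
      rw [pairVelocity_of_norm_eq_one φ (hn x t ht) (hn y t ht), inner_smul_right,
        inner_sub_right, inner_smul_right]
      set s : ℝ := inner ℝ (u x t) (u y t)
      set ax : ℝ := inner ℝ e (u x t)
      set ay : ℝ := inner ℝ e (u y t)
      have hs : |s| ≤ 1 := abs_inner_le_one (hn x t ht).le (hn y t ht).le
      have hs' := abs_le.1 hs
      have h1 : a - ay ≤ c := hall y
      have h2 : a - ax ≤ c := hall x
      have h3 : -(2 * c) ≤ ay - s * ax := by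
        rcases le_total 0 ax with h4 | h4
        · nlinarith
        · nlinarith
      have h4 := h.nonneg s
      have h5 := h.le s
      nlinarith
    rw [inner_meanVelocity h (hu.aestronglyMeasurable t ht)]
    have hint : Integrable (fun y => inner ℝ e (pairVelocity φ (u x t) (u y t))) μ :=
      (integrable_pairVelocity h (hu.aestronglyMeasurable t ht) (u x t)).const_inner e
    have := integral_mono (integrable_const (-(2 * M * c))) hint hlow
    simp only [integral_const, probReal_univ, one_smul] at this
    linarith

omit [CompleteSpace E] in
theorem IsMeanFieldFlow.unique (h : IsCoupling φ M L) {v : S → ℝ → E}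
    (hu : IsMeanFieldFlow φ μ u) (hv : IsMeanFieldFlow φ μ v)
    (hu1 : ∀ x t, 0 ≤ t → ‖u x t‖ = 1) (hv1 : ∀ x t, 0 ≤ t → ‖v x t‖ = 1)
    (h0 : ∀ x, u x 0 = v x 0) (x : S) {t : ℝ} (ht : 0 ≤ t) : u x t = v x t := by
  have hM := h.bound_nonneg
  have hL := h.lipschitz_nonneg
  refine sub_eq_zero.1 (eq_zero_of_norm_deriv_le_mul_sup (u := fun x t => u x t - v x t)
    (L := 4 * (L + M) * 2) (M := 2) (by positivity)
    (fun x t ht => (hu.hasDerivWithinAt x t ht).sub (hv.hasDerivWithinAt x t ht))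
    (fun x => sub_eq_zero.2 (h0 x)) (fun x t ht => ?_) (fun t ht c hc hall x => ?_) x ht)
  · refine (norm_sub_le _ _).trans ?_
    rw [hu1 x t ht, hv1 x t ht]; norm_num
  · refine (norm_meanVelocity_sub_le h (hu.aestronglyMeasurable t ht)
      (hv.aestronglyMeasurable t ht) hall _ _).trans ?_
    calc _ ≤ 4 * (L + M) * (c + c) := by gcongr; exact hall x
      _ = _ := by ring

end Invariance

/-! ### Consensus -/

section Symmetrization

variable {S E : Type*} [MeasurableSpace S] {μ : Measure S} [IsProbabilityMeasure μ]
  [NormedAddCommGroup E] [InnerProductSpace ℝ E] [CompleteSpace E]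
  {φ : ℝ → ℝ} {M L : ℝ} {u : S → E}

/-- For unit vectors, `1 - x · y` is half the squared distance: this is the variance of `u`. -/
theorem integral_integral_one_sub_inner (hu : Integrable u μ) :
    ∫ x, ∫ y, (1 - inner ℝ (u x) (u y)) ∂μ ∂μ = 1 - ‖∫ x, u x ∂μ‖ ^ 2 := by
  have h1 : ∀ x, ∫ y, (1 - inner ℝ (u x) (u y)) ∂μ = 1 - inner ℝ (∫ y, u y ∂μ) (u x) := by
    intro x
    rw [integral_sub (integrable_const _) (hu.const_inner _), integral_inner hu,
      real_inner_comm]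
    simp
  simp_rw [h1]
  rw [integral_sub (integrable_const _) (hu.const_inner _), integral_inner hu,
    real_inner_self_eq_norm_sq]
  simp

/-- The momentum of a symmetric interaction, tested against `e`: exchanging the two particles turns
`y - (x · y) x` into the mean of this vector and `x - (x · y) y`, that is `(1 - x · y) (x + y) / 2`.
-/
theorem two_mul_inner_integral_meanVelocity (h : IsCoupling φ M L)
    (hu : AEStronglyMeasurable u μ) (hu1 : ∀ x, ‖u x‖ = 1) (e : E) :
    2 * inner ℝ e (∫ x, meanVelocity φ μ u (u x) ∂μ) =
      ∫ x, ∫ y, φ (inner ℝ (u x) (u y)) * (1 - inner ℝ (u x) (u y)) *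
        inner ℝ e (u x + u y) ∂μ ∂μ := by
  have hV : Integrable (fun p : S × S => pairVelocity φ (u p.1) (u p.2)) (μ.prod μ) :=
    Integrable.of_bound ((continuous_pairVelocity h).comp_aestronglyMeasurable
      (hu.comp_fst.prodMk hu.comp_snd)) (2 * M)
      (Eventually.of_forall fun p => norm_pairVelocity_le h _ _)
  have hmean : Integrable (fun x => meanVelocity φ μ u (u x)) μ := hV.integral_prod_left
  have hVe : Integrable (fun p : S × S => inner ℝ e (pairVelocity φ (u p.1) (u p.2)))
      (μ.prod μ) := hV.const_inner e
  have hVe' : Integrable (fun p : S × S => inner ℝ e (pairVelocity φ (u p.2) (u p.1)))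
      (μ.prod μ) := hVe.swap
  have h1 : inner ℝ e (∫ x, meanVelocity φ μ u (u x) ∂μ) =
      ∫ x, ∫ y, inner ℝ e (pairVelocity φ (u x) (u y)) ∂μ ∂μ := by
    rw [← integral_inner hmean]
    simp_rw [inner_meanVelocity h hu]
  have h2 : ∫ x, ∫ y, inner ℝ e (pairVelocity φ (u x) (u y)) ∂μ ∂μ =
      ∫ x, ∫ y, inner ℝ e (pairVelocity φ (u y) (u x)) ∂μ ∂μ :=
    integral_integral_swap hVe
  rw [two_mul]
  nth_rewrite 2 [h1]
  rw [h2, h1, ← integral_integral_add' hVe hVe']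
  refine integral_congr_ae (Eventually.of_forall fun x => ?_)
  refine integral_congr_ae (Eventually.of_forall fun y => ?_)
  simp only [Pi.add_apply, pairVelocity_of_norm_eq_one φ (hu1 _) (hu1 _), inner_smul_right,
    inner_sub_right, inner_add_right, real_inner_comm (u x) (u y)]
  ring

/-- The mean velocity is at most `M` times the defect, and its component along `e` is at least
`κ a` times the defect when all pairs interact with strength at least `κ` and all particles lie in
the cap `{x · e ≥ a}`. -/
theorem norm_integral_meanVelocity_le_and_le_inner (h : IsCoupling φ M L)
    (hu : AEStronglyMeasurable u μ) (hu1 : ∀ x, ‖u x‖ = 1) {κ a : ℝ} (ha : 0 ≤ a)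
    {e : E} (hφ : ∀ x y, κ ≤ φ (inner ℝ (u x) (u y))) (hea : ∀ x, a ≤ inner ℝ e (u x)) :
    ‖∫ x, meanVelocity φ μ u (u x) ∂μ‖ ≤ M * (1 - ‖∫ x, u x ∂μ‖ ^ 2) ∧
      κ * a * (1 - ‖∫ x, u x ∂μ‖ ^ 2) ≤ inner ℝ e (∫ x, meanVelocity φ μ u (u x) ∂μ) := by
  have hM := h.bound_nonneg
  have hint : Integrable u μ :=
    Integrable.of_bound hu 1 (Eventually.of_forall fun x => (hu1 x).le)
  have hs : ∀ x y, |inner ℝ (u x) (u y)| ≤ 1 := fun x y =>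
    abs_inner_le_one (hu1 x).le (hu1 y).le
  have hmeas : AEStronglyMeasurable (fun p : S × S => (u p.1, u p.2)) (μ.prod μ) :=
    hu.comp_fst.prodMk hu.comp_snd
  have hφc : Continuous φ := by
    refine (LipschitzWith.of_dist_le_mul (K := ⟨L, h.lipschitz_nonneg⟩) fun s t => ?_).continuous
    exact h.lipschitz s t
  have hw : Integrable (fun p : S × S => 1 - inner ℝ (u p.1) (u p.2)) (μ.prod μ) := by
    refine Integrable.of_bound (Continuous.comp_aestronglyMeasurable
      (g := fun q : E × E => 1 - inner ℝ q.1 q.2) (by fun_prop) hmeas) 2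
      (Eventually.of_forall fun p => ?_)
    have := abs_le.1 (hs p.1 p.2)
    rw [Real.norm_eq_abs, abs_le]
    constructor <;> linarith
  have hG : ∀ e : E, Integrable (fun p : S × S => φ (inner ℝ (u p.1) (u p.2)) *
      (1 - inner ℝ (u p.1) (u p.2)) * inner ℝ e (u p.1 + u p.2)) (μ.prod μ) := by
    intro e
    refine Integrable.of_bound (Continuous.comp_aestronglyMeasurable
      (g := fun q : E × E => φ (inner ℝ q.1 q.2) * (1 - inner ℝ q.1 q.2) * inner ℝ e (q.1 + q.2))
      (by fun_prop) hmeas) (M * 2 * (‖e‖ * 2)) (Eventually.of_forall fun p => ?_)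
    rw [norm_mul, norm_mul, Real.norm_of_nonneg (h.nonneg _)]
    gcongr
    · exact h.le _
    · have := abs_le.1 (hs p.1 p.2)
      rw [Real.norm_eq_abs, abs_le]
      constructor <;> linarith
    · refine (norm_inner_le_norm _ _).trans ?_
      gcongr
      refine (norm_add_le _ _).trans ?_
      rw [hu1, hu1]; norm_num
  have hdef : ∫ p, (1 - inner ℝ (u p.1) (u p.2)) ∂(μ.prod μ) = 1 - ‖∫ x, u x ∂μ‖ ^ 2 := by
    rw [integral_prod _ hw, integral_integral_one_sub_inner hint]
  have hpair : ∀ e : E, 2 * inner ℝ e (∫ x, meanVelocity φ μ u (u x) ∂μ) =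
      ∫ p, φ (inner ℝ (u p.1) (u p.2)) * (1 - inner ℝ (u p.1) (u p.2)) *
        inner ℝ e (u p.1 + u p.2) ∂(μ.prod μ) := fun e => by
    rw [two_mul_inner_integral_meanVelocity h hu hu1, integral_prod _ (hG e)]
  constructor
  · set D := ∫ x, meanVelocity φ μ u (u x) ∂μ
    have h1 : 2 * inner ℝ D D ≤ ∫ p, (2 * M * ‖D‖) * (1 - inner ℝ (u p.1) (u p.2)) ∂(μ.prod μ) := by
      rw [hpair D]
      refine integral_mono (hG D) (hw.const_mul _) fun p => ?_
      have hs1 : 0 ≤ 1 - inner ℝ (u p.1) (u p.2) := by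
        have := abs_le.1 (hs p.1 p.2); linarith
      have h2 : inner ℝ D (u p.1 + u p.2) ≤ ‖D‖ * 2 := by
        refine (real_inner_le_norm _ _).trans ?_
        gcongr
        refine (norm_add_le _ _).trans ?_
        rw [hu1, hu1]; norm_num
      calc _ ≤ φ (inner ℝ (u p.1) (u p.2)) * (1 - inner ℝ (u p.1) (u p.2)) * (‖D‖ * 2) :=
            mul_le_mul_of_nonneg_left h2 (mul_nonneg (h.nonneg _) hs1)
        _ ≤ M * (1 - inner ℝ (u p.1) (u p.2)) * (‖D‖ * 2) := by gcongr; exact h.le _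
        _ = _ := by ring
    rw [integral_const_mul, hdef, real_inner_self_eq_norm_sq] at h1
    have hnn : 0 ≤ 1 - ‖∫ x, u x ∂μ‖ ^ 2 := by
      rw [← hdef]
      exact integral_nonneg fun p => by
        have := abs_le.1 (hs p.1 p.2); simp only [Pi.zero_apply]; linarith
    rcases (norm_nonneg D).eq_or_lt with h0 | h0
    · rw [← h0]; positivity
    · nlinarith
  · have h1 : ∫ p, (κ * (2 * a)) * (1 - inner ℝ (u p.1) (u p.2)) ∂(μ.prod μ) ≤
        2 * inner ℝ e (∫ x, meanVelocity φ μ u (u x) ∂μ) := by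
      rw [hpair e]
      refine integral_mono (hw.const_mul _) (hG e) fun p => ?_
      have hs1 : 0 ≤ 1 - inner ℝ (u p.1) (u p.2) := by
        have := abs_le.1 (hs p.1 p.2); linarith
      have h2 : 2 * a ≤ inner ℝ e (u p.1 + u p.2) := by
        rw [inner_add_right]; linarith [hea p.1, hea p.2]
      calc _ = κ * (1 - inner ℝ (u p.1) (u p.2)) * (2 * a) := by ring
        _ ≤ φ (inner ℝ (u p.1) (u p.2)) * (1 - inner ℝ (u p.1) (u p.2)) *
            inner ℝ e (u p.1 + u p.2) := by
          gcongr
          · exact mul_nonneg (h.nonneg _) hs1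
          · exact hφ _ _
    rw [integral_const_mul, hdef] at h1
    linarith

end Symmetrization

/-- A curve `c` in the unit ball whose speed is at most `M (1 - ‖c‖ ^ 2)` and whose component along
`e` grows at least at the rate `κ (1 - ‖c‖ ^ 2)` converges to a unit vector: the bounded monotone
quantity `e · c` controls its length. -/
theorem exists_tendsto_of_norm_deriv_le {E : Type*} [NormedAddCommGroup E] [InnerProductSpace ℝ E]
    [CompleteSpace E] {c c' : ℝ → E} {e : E} {M κ : ℝ} (hκ : 0 < κ) (hM : 0 ≤ M)
    (hc : ∀ t, 0 ≤ t → HasDerivWithinAt c (c' t) (Ici 0) t) (hc1 : ∀ t, 0 ≤ t → ‖c t‖ ≤ 1)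
    (hspeed : ∀ t, 0 ≤ t → ‖c' t‖ ≤ M * (1 - ‖c t‖ ^ 2))
    (hgrow : ∀ t, 0 ≤ t → κ * (1 - ‖c t‖ ^ 2) ≤ inner ℝ e (c' t)) :
    ∃ p : E, ‖p‖ = 1 ∧ Tendsto (fun t : ℝ≥0 => c t) atTop (𝓝 p) := by
  set w : ℝ → ℝ := fun t => inner ℝ e (c t) with hw
  have hw' : ∀ t, 0 ≤ t → HasDerivWithinAt w (inner ℝ e (c' t)) (Ici 0) t := fun t ht =>
    (innerSL ℝ e).hasFDerivAt.comp_hasDerivWithinAt t (hc t ht)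
  have hwb : ∀ t, 0 ≤ t → w t ≤ ‖e‖ := fun t ht => by
    refine (real_inner_le_norm _ _).trans ?_
    exact mul_le_of_le_one_right (norm_nonneg _) (hc1 t ht)
  have hlen : ∀ s t, 0 ≤ s → s ≤ t → ‖c t - c s‖ ≤ M / κ * (w t - w s) := by
    intro s t hs hst
    refine image_norm_le_of_norm_deriv_right_le_deriv_boundary' (a := s) (b := t)
      (f := fun τ => c τ - c s) (f' := c') (B := fun τ => M / κ * (w τ - w s))
      (B' := fun τ => M / κ * inner ℝ e (c' τ)) ?_ ?_ (by simp) ?_ ?_ ?_ ⟨hst, le_rfl⟩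
    · exact fun τ hτ => (((hc τ (hs.trans hτ.1)).sub_const _).continuousWithinAt.mono
        ((Icc_subset_Ici_self).trans (Ici_subset_Ici.2 hs)))
    · exact fun τ hτ => (((hc τ (hs.trans hτ.1)).sub_const _).mono
        (Ici_subset_Ici.2 (hs.trans hτ.1)))
    · exact fun τ hτ => ((((hw' τ (hs.trans hτ.1)).sub_const _).const_mul _).continuousWithinAt.mono
        ((Icc_subset_Ici_self).trans (Ici_subset_Ici.2 hs)))
    · exact fun τ hτ => ((((hw' τ (hs.trans hτ.1)).sub_const _).const_mul _).mono
        (Ici_subset_Ici.2 (hs.trans hτ.1)))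
    · intro τ hτ
      have h0 := hs.trans hτ.1
      calc ‖c' τ‖ ≤ M * (1 - ‖c τ‖ ^ 2) := hspeed τ h0
        _ = M / κ * (κ * (1 - ‖c τ‖ ^ 2)) := by field_simp
        _ ≤ M / κ * inner ℝ e (c' τ) := by gcongr; exact hgrow τ h0
  -- `w` grows at least linearly as long as `c` stays away from the sphere.
  have hlin : ∀ s t η, 0 ≤ s → s ≤ t → (∀ τ, s ≤ τ → η ≤ 1 - ‖c τ‖ ^ 2) →
      w s + κ * η * (t - s) ≤ w t := by
    intro s t η hs hst hη
    refine image_le_of_deriv_right_le_deriv_boundary (a := s) (b := t)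
      (f := fun τ => w s + κ * η * (τ - s)) (f' := fun _ => κ * η) (B := w)
      (B' := fun τ => inner ℝ e (c' τ)) (by fun_prop) ?_ (by simp) ?_ ?_ ?_ ⟨hst, le_rfl⟩
    · intro τ _
      simpa using ((((hasDerivWithinAt_id τ (Ici τ)).sub_const s).const_mul (κ * η)).const_add
        (w s))
    · exact fun τ hτ => ((hw' τ (hs.trans hτ.1)).continuousWithinAt.mono
        ((Icc_subset_Ici_self).trans (Ici_subset_Ici.2 hs)))
    · exact fun τ hτ => ((hw' τ (hs.trans hτ.1)).mono (Ici_subset_Ici.2 (hs.trans hτ.1)))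
    · intro τ hτ
      refine le_trans ?_ (hgrow τ (hs.trans hτ.1))
      exact mul_le_mul_of_nonneg_left (hη τ hτ.1) hκ.le
  have hmono : Monotone fun t : ℝ≥0 => w t := by
    intro s t hst
    have hst' : (s : ℝ) ≤ t := hst
    have hball : ∀ τ : ℝ, (s : ℝ) ≤ τ → (0 : ℝ) ≤ 1 - ‖c τ‖ ^ 2 := fun τ hτ => by
      have h1 := hc1 τ (s.2.trans hτ)
      have h2 := norm_nonneg (c τ)
      nlinarith
    have := hlin s t 0 s.2 hst' hball
    simpa using this
  have hbdd : BddAbove (range fun t : ℝ≥0 => w t) := ⟨‖e‖, by rintro _ ⟨t, rfl⟩; exact hwb t t.2⟩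
  have hlim := tendsto_atTop_ciSup hmono hbdd
  set ℓ := ⨆ t : ℝ≥0, w t
  have hle : ∀ t : ℝ≥0, w t ≤ ℓ := fun t => le_ciSup hbdd t
  have hcauchy : CauchySeq fun t : ℝ≥0 => c t := by
    refine cauchySeq_of_le_tendsto_0 (fun t : ℝ≥0 => M / κ * (ℓ - w t)) ?_ ?_
    · intro n m N hn hm
      have hMκ : 0 ≤ M / κ := by positivity
      wlog hnm : n ≤ m generalizing n m
      · rw [dist_comm]
        exact this m n hm hn (le_of_not_ge hnm)
      rw [dist_comm, dist_eq_norm]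
      refine (hlen n m n.2 hnm).trans ?_
      have h1 := hle m
      have h2 : w N ≤ w n := hmono hn
      gcongr
    · simpa using (hlim.const_sub ℓ).const_mul (M / κ)
  obtain ⟨p, hp⟩ := cauchySeq_tendsto_of_complete hcauchy
  refine ⟨p, ?_, hp⟩
  have hp1 : ‖p‖ ≤ 1 := le_of_tendsto' hp.norm fun t => hc1 t t.2
  by_contra hne
  have hlt : ‖p‖ < 1 := lt_of_le_of_ne hp1 hne
  set η := (1 - ‖p‖ ^ 2) / 2 with hη
  have hηpos : 0 < η := by have := norm_nonneg p; rw [hη]; nlinarith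
  have hev : ∀ᶠ t : ℝ≥0 in atTop, η < 1 - ‖c t‖ ^ 2 :=
    ((hp.norm.pow 2).const_sub 1).eventually_const_lt (by linarith)
  obtain ⟨T, hT⟩ := eventually_atTop.1 hev
  have hT' : ∀ τ : ℝ, (T : ℝ) ≤ τ → η ≤ 1 - ‖c τ‖ ^ 2 := fun τ hτ =>
    (hT ⟨τ, T.2.trans hτ⟩ hτ).le
  have hfar := hlin T (T + ((‖e‖ - w T) / (κ * η) + 1)) η T.2 (by
    have := hwb T T.2
    have : 0 ≤ (‖e‖ - w T) / (κ * η) := div_nonneg (by linarith) (by positivity)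
    linarith) hT'
  have hb := hwb (T + ((‖e‖ - w T) / (κ * η) + 1)) (by
    have := hwb T T.2
    have : 0 ≤ (‖e‖ - w T) / (κ * η) := div_nonneg (by linarith) (by positivity)
    have := T.2
    positivity)
  have h3 : κ * η * (↑T + ((‖e‖ - w ↑T) / (κ * η) + 1) - ↑T) = ‖e‖ - w T + κ * η := by
    field_simp
    ring
  have h4 : 0 < κ * η := by positivity
  linarith

/-! ### The coupling strength of the potential -/

open Real in
theorem two_div_pi_mul_arccos_le_norm_sub {E : Type*} [NormedAddCommGroup E]
    [InnerProductSpace ℝ E] {x y : E} (hx : ‖x‖ = 1) (hy : ‖y‖ = 1) :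
    2 / π * arccos (inner ℝ x y) ≤ ‖x - y‖ := by
  set θ := arccos (inner ℝ x y) with hθ
  have h0 : 0 ≤ θ := arccos_nonneg _
  have hπ : θ ≤ π := arccos_le_pi _
  have h1 := mul_le_sin (x := θ / 2) (by linarith) (by linarith)
  have hin := abs_le.1 (abs_inner_le_one hx.le hy.le)
  have hcos : cos θ = inner ℝ x y := cos_arccos hin.1 hin.2
  have h2 : ‖x - y‖ ^ 2 = (2 * sin (θ / 2)) ^ 2 := by
    rw [norm_sub_sq_real, hx, hy, ← hcos, mul_pow, sin_sq_eq_half_sub]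
    rw [mul_div_cancel₀ _ (two_ne_zero)]
    ring
  have hs : 0 ≤ sin (θ / 2) := sin_nonneg_of_nonneg_of_le_pi (by linarith) (by linarith)
  have h3 : ‖x - y‖ = 2 * sin (θ / 2) :=
    (pow_left_inj₀ (norm_nonneg _) (by positivity) two_ne_zero).1 h2
  rw [h3]
  linarith

open Real in
/-- On `[0, b]` with `b < π`, a function whose derivative is at most `A * θ` is Lipschitz as a
function of `cos θ`: compare it with `B * cos θ`, whose derivative is at least of the same size. -/
theorem exists_abs_sub_le_mul_cos_sub {b A : ℝ} (hb0 : 0 < b) (hb : b < π) (hA : 0 ≤ A)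
    {f f' : ℝ → ℝ} (hf : ContinuousOn f (Icc 0 b))
    (hf' : ∀ θ ∈ Ioo 0 b, HasDerivAt f (f' θ) θ) (hbound : ∀ θ ∈ Ioo 0 b, |f' θ| ≤ A * θ) :
    ∃ B, 0 ≤ B ∧ ∀ θ ∈ Icc 0 b, ∀ τ ∈ Icc 0 b, |f θ - f τ| ≤ B * |cos θ - cos τ| := by
  have hsb : 0 < sin b := sin_pos_of_pos_of_lt_pi hb0 hb
  have hsin : ∀ θ ∈ Ioo 0 b, sin b / b * θ ≤ sin θ := by
    intro θ hθ
    have h := strictConcaveOn_sin_Icc.concaveOn.2 (⟨le_rfl, pi_nonneg⟩ : (0 : ℝ) ∈ Icc 0 π)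
      (⟨hb0.le, hb.le⟩ : b ∈ Icc 0 π)
      (show 0 ≤ 1 - θ / b by rw [sub_nonneg, div_le_one hb0]; exact hθ.2.le)
      (div_nonneg hθ.1.le hb0.le) (by ring)
    simp only [smul_eq_mul, mul_zero, sin_zero, zero_add] at h
    rw [div_mul_cancel₀ _ hb0.ne'] at h
    calc _ = θ / b * sin b := by ring
      _ ≤ _ := h
  set B := A * b / sin b with hB
  have hB0 : 0 ≤ B := by positivity
  have hAB : ∀ θ ∈ Ioo 0 b, A * θ ≤ B * sin θ := by
    intro θ hθ
    calc A * θ = B * (sin b / b * θ) := by rw [hB]; field_simp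
      _ ≤ _ := mul_le_mul_of_nonneg_left (hsin θ hθ) hB0
  have hmono : ∀ σ : ℝ, |σ| = 1 → MonotoneOn (fun θ => σ * f θ - B * cos θ) (Icc 0 b) := by
    intro σ hσ
    refine monotoneOn_of_hasDerivWithinAt_nonneg (f' := fun θ => σ * f' θ + B * sin θ)
      (convex_Icc 0 b) (by fun_prop) ?_ ?_
    · intro θ hθ
      rw [interior_Icc] at hθ
      have := ((hf' θ hθ).const_mul σ).sub ((hasDerivAt_cos θ).const_mul B)
      rw [mul_neg, sub_neg_eq_add] at this
      exact this.hasDerivWithinAt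
    · intro θ hθ
      rw [interior_Icc] at hθ
      have h1 : |σ * f' θ| ≤ A * θ := by rw [abs_mul, hσ, one_mul]; exact hbound θ hθ
      have := (abs_le.1 h1).1
      have := hAB θ hθ
      linarith
  refine ⟨B, hB0, fun θ hθ τ hτ => ?_⟩
  wlog hle : θ ≤ τ generalizing θ τ
  · rw [abs_sub_comm, abs_sub_comm (cos θ)]
    exact this τ hτ θ hθ (le_of_not_ge hle)
  have h1 := hmono 1 (by simp) hθ hτ hle
  have h2 := hmono (-1) (by simp) hθ hτ hle
  have h3 : cos τ ≤ cos θ := cos_le_cos_of_nonneg_of_le_pi hθ.1 (hτ.2.trans hb.le) hle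
  simp only at h1 h2
  rw [abs_of_nonneg (sub_nonneg.2 h3), abs_le]
  constructor <;> linarith

open Real in
theorem sinc_pos_of_lt_pi {θ : ℝ} (h0 : 0 ≤ θ) (hπ : θ < π) : 0 < sinc θ := by
  rcases h0.eq_or_lt with h | h
  · rw [← h, sinc_zero]; exact one_pos
  · rw [sinc_of_ne_zero h.ne']
    exact div_pos (sin_pos_of_pos_of_lt_pi h hπ) h

open Real in
/-- The function `θ / sin θ`, extended by `1` to `θ = 0`, is Lipschitz as a function of `cos θ`
away from `θ = π`. -/
theorem exists_abs_inv_sinc_sub_le {b : ℝ} (hb0 : 0 < b) (hb : b < π) :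
    ∃ B, 0 ≤ B ∧ ∀ θ ∈ Icc 0 b, ∀ τ ∈ Icc 0 b,
      |(sinc θ)⁻¹ - (sinc τ)⁻¹| ≤ B * |cos θ - cos τ| := by
  have hpos : ∀ θ ∈ Icc 0 b, 0 < sinc θ := fun θ hθ =>
    sinc_pos_of_lt_pi hθ.1 (hθ.2.trans_lt hb)
  obtain ⟨θ₀, hθ₀, hmin⟩ := isCompact_Icc.exists_isMinOn (nonempty_Icc.2 hb0.le)
    continuous_sinc.continuousOn (s := Icc 0 b)
  set m := sinc θ₀
  have hm : 0 < m := hpos θ₀ hθ₀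
  refine exists_abs_sub_le_mul_cos_sub (A := 1 / (2 * m ^ 2)) hb0 hb (by positivity)
    (f' := fun θ => (sin θ - θ * cos θ) / sin θ ^ 2)
    (continuous_sinc.continuousOn.inv₀ fun θ hθ => (hpos θ hθ).ne') ?_ ?_
  · intro θ hθ
    have hs : sin θ ≠ 0 := (sin_pos_of_pos_of_lt_pi hθ.1 (hθ.2.trans hb)).ne'
    have h1 : HasDerivAt (fun x => x / sin x) ((1 * sin θ - θ * cos θ) / sin θ ^ 2) θ :=
      (hasDerivAt_id θ).div (hasDerivAt_sin θ) hs
    rw [one_mul] at h1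
    refine h1.congr_of_eventuallyEq ?_
    filter_upwards [isOpen_ne.mem_nhds hθ.1.ne'] with x hx
    rw [sinc_of_ne_zero hx, inv_div]
  · intro θ hθ
    have hθ0 := hθ.1
    have hs : 0 < sin θ := sin_pos_of_pos_of_lt_pi hθ.1 (hθ.2.trans hb)
    have h1 : m * θ ≤ sin θ := by
      have h : m ≤ sinc θ := hmin ⟨hθ.1.le, hθ.2.le⟩
      rw [sinc_of_ne_zero hθ0.ne', le_div_iff₀ hθ0] at h
      exact h
    have h2 : sin θ ≤ θ := sin_le hθ0.le
    have h3 := one_sub_sq_div_two_le_cos (x := θ)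
    have h4 : 0 ≤ sin θ - θ * cos θ := by
      rcases lt_or_ge θ (π / 2) with h | h
      · have hc : 0 < cos θ := cos_pos_of_mem_Ioo ⟨by linarith, h⟩
        have ht := le_tan hθ0.le h
        rw [tan_eq_sin_div_cos, le_div_iff₀ hc] at ht
        linarith
      · have hc : cos θ ≤ 0 := cos_nonpos_of_pi_div_two_le_of_le h (by linarith [hθ.2])
        nlinarith
    rw [abs_of_nonneg (by positivity)]
    have h5 : sin θ - θ * cos θ ≤ θ ^ 3 / 2 := by nlinarith
    calc (sin θ - θ * cos θ) / sin θ ^ 2 ≤ (θ ^ 3 / 2) / (m * θ) ^ 2 := by gcongr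
      _ = _ := by field_simp

/-- The coupling strength as a function of `s = cos d`, namely `2 g'(d²) d / sin d`, frozen for
`d ≥ b` in order to stay away from the singularity at antipodal points. Beyond `s = 1` it is
constant because `arccos` is. -/
noncomputable def couplingOf (g : ℝ → ℝ) (b s : ℝ) : ℝ :=
  2 * derivHalf g (Real.arccos (max s (Real.cos b)) ^ 2) *
    (Real.sinc (Real.arccos (max s (Real.cos b))))⁻¹

theorem couplingOf_cos (g : ℝ → ℝ) {b θ : ℝ} (hθ : 0 ≤ θ) (hθb : θ ≤ b) (hb : b < Real.pi) :
    couplingOf g b (Real.cos θ) = 2 * derivHalf g (θ ^ 2) * (Real.sinc θ)⁻¹ := by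
  rw [couplingOf, max_eq_left (Real.cos_le_cos_of_nonneg_of_le_pi hθ hb.le hθb),
    Real.arccos_cos hθ (hθb.trans hb.le)]

open Real in
theorem exists_isCoupling_couplingOf {g : ℝ → ℝ} (hK : PotentialHyp g)
    (hg : ∀ s : ℝ, 0 ≤ s → 0 ≤ derivHalf g s) {b : ℝ} (hb0 : 0 < b) (hb : b < π) :
    ∃ M L, IsCoupling (couplingOf g b) M L := by
  have hpos : ∀ θ ∈ Icc 0 b, 0 < sinc θ := fun θ hθ =>
    sinc_pos_of_lt_pi hθ.1 (hθ.2.trans_lt hb)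
  obtain ⟨P, hP⟩ : ∃ P : ℝ≥0, LipschitzOnWith P (derivHalf g) (Icc 0 (b ^ 2)) :=
    (hK.2.mono Icc_subset_Ici_self).exists_lipschitzOnWith_of_compact isCompact_Icc
  obtain ⟨B₁, hB₁, hB₁'⟩ := exists_abs_sub_le_mul_cos_sub (A := 2) (f := fun θ => θ ^ 2)
    (f' := fun θ => 2 * θ) hb0 hb (by norm_num) (by fun_prop)
    (fun θ _ => by simpa using hasDerivAt_pow 2 θ)
    (fun θ hθ => by rw [abs_of_nonneg (by linarith [hθ.1])])
  obtain ⟨B₂, hB₂, hB₂'⟩ := exists_abs_inv_sinc_sub_le hb0 hb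
  obtain ⟨A₁, hA₁⟩ := isCompact_Icc.exists_bound_of_continuousOn hP.continuousOn
  obtain ⟨A₂, hA₂⟩ := (isCompact_Icc (a := (0 : ℝ)) (b := b)).exists_bound_of_continuousOn
    (continuous_sinc.continuousOn.inv₀ fun θ hθ => (hpos θ hθ).ne')
  have hsq : ∀ θ ∈ Icc 0 b, θ ^ 2 ∈ Icc 0 (b ^ 2) := fun θ hθ =>
    ⟨by positivity, pow_le_pow_left₀ hθ.1 hθ.2 2⟩
  have hmem : ∀ s, arccos (max s (cos b)) ∈ Icc 0 b := fun s =>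
    ⟨arccos_nonneg _, by
      calc _ ≤ arccos (cos b) := arccos_le_arccos (le_max_right _ _)
        _ = b := arccos_cos hb0.le hb.le⟩
  -- Taking the cosine undoes the clamped `arccos`, except for the clamping, which is `1`-Lipschitz.
  have hcos : ∀ s t, |cos (arccos (max s (cos b))) - cos (arccos (max t (cos b)))| ≤ |s - t| := by
    have h : ∀ s, cos (arccos (max s (cos b))) = min 1 (max s (cos b)) := by
      intro s
      rcases le_total (max s (cos b)) 1 with h | h
      · rw [min_eq_right h, cos_arccos ((neg_one_le_cos b).trans (le_max_right _ _)) h]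
      · rw [min_eq_left h, arccos_of_one_le h, cos_zero]
    intro s t
    rw [h, h, min_comm, min_comm 1]
    refine (abs_min_sub_min_le_max _ _ _ _).trans ?_
    rw [sub_self, abs_zero, max_eq_left (abs_nonneg _)]
    exact abs_max_sub_max_le_abs _ _ _
  have hA₁0 : 0 ≤ A₁ := (norm_nonneg _).trans (hA₁ 0 ⟨le_rfl, by positivity⟩)
  have hA₂0 : 0 ≤ A₂ := (norm_nonneg _).trans (hA₂ 0 ⟨le_rfl, hb0.le⟩)
  refine ⟨2 * A₁ * A₂, 2 * (A₁ * B₂ + P * B₁ * A₂), ?_, ?_, ?_⟩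
  · intro s
    have := hpos _ (hmem s)
    have := hg (arccos (max s (cos b)) ^ 2) (by positivity)
    unfold couplingOf
    positivity
  · intro s
    have h1 := (le_abs_self _).trans (hA₁ _ (hsq _ (hmem s)))
    have h2 : (sinc (arccos (max s (cos b))))⁻¹ ≤ A₂ := (le_abs_self _).trans (hA₂ _ (hmem s))
    have := hpos _ (hmem s)
    unfold couplingOf
    gcongr
  · intro s t
    unfold couplingOf
    have hc := hcos s t
    have hs := hmem s
    have ht := hmem t
    set θ := arccos (max s (cos b))
    set τ := arccos (max t (cos b))
    have h1 : |derivHalf g (θ ^ 2)| ≤ A₁ := hA₁ _ (hsq θ hs)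
    have h2 : |(sinc τ)⁻¹| ≤ A₂ := hA₂ _ ht
    have h3 : |derivHalf g (θ ^ 2) - derivHalf g (τ ^ 2)| ≤ P * |θ ^ 2 - τ ^ 2| := by
      simpa [Real.dist_eq] using hP.dist_le_mul _ (hsq θ hs) _ (hsq τ ht)
    have h4 := hB₁' θ hs τ ht
    have h5 := hB₂' θ hs τ ht
    have hdec : 2 * derivHalf g (θ ^ 2) * (sinc θ)⁻¹ - 2 * derivHalf g (τ ^ 2) * (sinc τ)⁻¹ =
        2 * (derivHalf g (θ ^ 2) * ((sinc θ)⁻¹ - (sinc τ)⁻¹) +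
          (derivHalf g (θ ^ 2) - derivHalf g (τ ^ 2)) * (sinc τ)⁻¹) := by ring
    rw [hdec, abs_mul, abs_two]
    calc _ ≤ 2 * (|derivHalf g (θ ^ 2)| * |(sinc θ)⁻¹ - (sinc τ)⁻¹| +
          |derivHalf g (θ ^ 2) - derivHalf g (τ ^ 2)| * |(sinc τ)⁻¹|) := by
          rw [← abs_mul, ← abs_mul]; gcongr; exact abs_add_le _ _
      _ ≤ 2 * (A₁ * (B₂ * |s - t|) + P * (B₁ * |s - t|) * A₂) := by
          gcongr
          · exact h5.trans (by gcongr)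
          · exact h3.trans (by gcongr; exact h4.trans (by gcongr))
      _ = _ := by ring

/-! ### The velocity field on the disk -/

section Geometry

variable {k : ℕ} {ε : ℝ} {g : ℝ → ℝ}

theorem norm_coe_sph (x : Sph k) : ‖(x : Amb k)‖ = 1 := norm_eq_of_mem_sphere x

theorem geoDist_eq_angle (x y : Sph k) :
    geoDist x y = InnerProductGeometry.angle (x : Amb k) (y : Amb k) := by
  rw [geoDist, InnerProductGeometry.angle, norm_coe_sph, norm_coe_sph, mul_one, div_one]

theorem cos_geoDist (x y : Sph k) : Real.cos (geoDist x y) = inner ℝ (x : Amb k) (y : Amb k) := by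
  have h := abs_le.1 (abs_inner_le_one (norm_coe_sph x).le (norm_coe_sph y).le)
  exact Real.cos_arccos h.1 h.2

theorem geoDist_nonneg (x y : Sph k) : 0 ≤ geoDist x y := Real.arccos_nonneg _

theorem geoDist_self (x : Sph k) : geoDist x x = 0 := by
  rw [geoDist, real_inner_self_eq_norm_sq, norm_coe_sph]; simp

theorem geoDist_comm (x y : Sph k) : geoDist x y = geoDist y x := by
  rw [geoDist, geoDist, real_inner_comm]

theorem geoDist_triangle (x y z : Sph k) : geoDist x z ≤ geoDist x y + geoDist y z := by
  simp only [geoDist_eq_angle]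
  exact InnerProductGeometry.angle_le_angle_add_angle _ _ _

theorem geoDist_le_mul_norm_sub (x y : Sph k) :
    geoDist x y ≤ Real.pi / 2 * ‖(x : Amb k) - y‖ := by
  have h := two_div_pi_mul_arccos_le_norm_sub (norm_coe_sph x) (norm_coe_sph y)
  have hπ := Real.pi_pos
  calc geoDist x y = Real.pi / 2 * (2 / Real.pi * geoDist x y) := by field_simp
    _ ≤ _ := by gcongr; exact h

theorem geoDist_lt_of_disk (x y : Disk k ε) : geoDist x.1 y.1 < Real.pi - 2 * ε := by
  have h1 := x.2
  have h2 := y.2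
  have h3 := geoDist_triangle x.1 (northPole k) y.1
  rw [geoDist_comm (northPole k)] at h3
  linarith

/-- At coinciding points the value `2 g'(0)` prescribed for `G` is the one given by `sinc 0 = 1`. -/
theorem interactionG_eq (x y : Sph k) :
    interactionG g x y =
      2 * derivHalf g (geoDist x y ^ 2) * (Real.sinc (geoDist x y))⁻¹ := by
  unfold interactionG
  split_ifs with h
  · rw [h, geoDist_self]; simp
  · have hne : geoDist x y ≠ 0 := by
      intro h0
      apply h
      have h1 := cos_geoDist x y
      rw [h0, Real.cos_zero] at h1
      exact Subtype.ext ((inner_eq_one_iff_of_norm_eq_one (𝕜 := ℝ) (norm_coe_sph x)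
        (norm_coe_sph y)).1 h1.symm)
    rw [Real.sinc_of_ne_zero hne, inv_div]

theorem couplingOf_inner {b : ℝ} (hb : b < Real.pi) {x y : Sph k} (hxy : geoDist x y ≤ b) :
    couplingOf g b (inner ℝ (x : Amb k) (y : Amb k)) = interactionG g x y := by
  rw [← cos_geoDist, couplingOf_cos g (geoDist_nonneg x y) hxy hb, interactionG_eq]

theorem coe_toSphere {z : Amb k} (hz : z ≠ 0) : (toSphere z : Amb k) = ‖z‖⁻¹ • z := by
  simp [toSphere, hz]

theorem toSphere_coe (x : Sph k) : toSphere (x : Amb k) = x := by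
  apply Subtype.ext
  rw [coe_toSphere (norm_ne_zero_iff.1 (by rw [norm_coe_sph]; exact one_ne_zero)), norm_coe_sph]
  simp

theorem eventually_ne_zero (x : Sph k) : ∀ᶠ z : Amb k in 𝓝 (x : Amb k), z ≠ 0 :=
  isOpen_ne.mem_nhds (norm_ne_zero_iff.1 (by rw [norm_coe_sph]; exact one_ne_zero))

/-- On the diagonal the gradient vanishes, because `d²` is quadratically small there and `g` has
a one-sided derivative at `0`. -/
theorem hasGradientAt_potential_self (hK : PotentialHyp g) (x : Sph k) :
    HasGradientAt (fun z : Amb k => potential g (toSphere z) x) 0 (x : Amb k) := by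
  rw [hasGradientAt_iff_hasFDerivAt, map_zero, hasFDerivAt_iff_isLittleO]
  simp only [toSphere_coe, zero_apply, sub_zero]
  have hu : (fun z : Amb k => geoDist (toSphere z) x ^ 2) =O[𝓝 (x : Amb k)]
      fun z => ‖z - (x : Amb k)‖ ^ 2 := by
    refine Asymptotics.IsBigO.of_bound (Real.pi ^ 2) ?_
    filter_upwards [eventually_ne_zero x] with z hz
    have h1 : ‖(toSphere z : Amb k) - x‖ ≤ 2 * ‖z - x‖ := by
      have hz' : ‖z‖ ≠ 0 := norm_ne_zero_iff.2 hz
      have h2 : ‖(toSphere z : Amb k) - z‖ ≤ ‖z - x‖ := by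
        have : (toSphere z : Amb k) - z = (‖z‖⁻¹ - 1) • z := by
          rw [coe_toSphere hz, sub_smul, one_smul]
        have h3 : (‖z‖⁻¹ - 1) * ‖z‖ = 1 - ‖z‖ := by field_simp
        have h4 := abs_norm_sub_norm_le (x : Amb k) z
        rw [norm_coe_sph, norm_sub_rev] at h4
        rwa [this, norm_smul, ← norm_norm z, ← norm_mul, norm_norm, h3, Real.norm_eq_abs]
      have : (toSphere z : Amb k) - x = ((toSphere z : Amb k) - z) + (z - x) := by abel
      rw [this]
      refine (norm_add_le _ _).trans ?_
      linarith
    have h2 := geoDist_le_mul_norm_sub (toSphere z) x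
    have hπ := Real.pi_pos
    have h3 : geoDist (toSphere z) x ≤ Real.pi * ‖z - x‖ := by
      calc _ ≤ Real.pi / 2 * (2 * ‖z - x‖) := h2.trans (by gcongr)
        _ = _ := by ring
    have h0 := geoDist_nonneg (toSphere z) x
    rw [Real.norm_of_nonneg (by positivity), Real.norm_of_nonneg (by positivity), ← mul_pow]
    gcongr
  have hsmall : (fun z : Amb k => ‖z - (x : Amb k)‖ ^ 2) =o[𝓝 (x : Amb k)] fun z => z - x := by
    have h1 : Tendsto (fun z : Amb k => z - x) (𝓝 (x : Amb k)) (𝓝 0) := by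
      have : Continuous fun z : Amb k => z - x := by fun_prop
      simpa using this.tendsto (x : Amb k)
    exact (Asymptotics.isLittleO_norm_pow_id one_lt_two).comp_tendsto h1
  have hlim : Tendsto (fun z : Amb k => geoDist (toSphere z) x ^ 2) (𝓝 (x : Amb k))
      (𝓝[Ici 0] 0) := by
    refine tendsto_nhdsWithin_iff.2 ⟨hu.trans_tendsto ?_, Eventually.of_forall fun z => ?_⟩
    · have : Continuous fun z : Amb k => ‖z - x‖ ^ 2 := by fun_prop
      simpa using this.tendsto (x : Amb k)
    · exact sq_nonneg (geoDist (toSphere z) x)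
  have hg := (hK.1 0 self_mem_Ici).hasFDerivWithinAt.isBigO_sub.comp_tendsto hlim
  simp only [Function.comp_def, sub_zero] at hg
  simpa only [potential, geoDist_self, ne_eq, OfNat.ofNat_ne_zero, not_false_eq_true, zero_pow]
    using (hg.trans hu).trans_isLittleO hsmall

theorem hasGradientAt_potential_of_ne (hK : PotentialHyp g) {x y : Sph k} (hne : x ≠ y)
    (hxy : geoDist x y < Real.pi) :
    HasGradientAt (fun z : Amb k => potential g (toSphere z) y)
      (-(interactionG g x y) • ((y : Amb k) - (inner ℝ (x : Amb k) (y : Amb k) : ℝ) • (x : Amb k)))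
      (x : Amb k) := by
  set s : ℝ := inner ℝ (x : Amb k) (y : Amb k) with hs
  set θ := geoDist x y with hθ
  have hcos : Real.cos θ = s := cos_geoDist x y
  have hθs : Real.arccos s = θ := rfl
  have hθ0 : 0 < θ := by
    refine (geoDist_nonneg x y).lt_of_ne' fun h0 => hne ?_
    change θ = 0 at h0
    rw [h0, Real.cos_zero] at hcos
    exact Subtype.ext ((inner_eq_one_iff_of_norm_eq_one (𝕜 := ℝ) (norm_coe_sph x)
      (norm_coe_sph y)).1 hcos.symm)
  have hsin : 0 < Real.sin θ := Real.sin_pos_of_pos_of_lt_pi hθ0 hxy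
  have hs1 : s ≠ 1 := fun h => by
    rw [← hθs, h, Real.arccos_one] at hθ0; exact lt_irrefl _ hθ0
  have hs2 : s ≠ -1 := fun h => by
    rw [← hθs, h, Real.arccos_neg_one] at hxy; exact lt_irrefl _ hxy
  have hF : HasDerivAt (fun s => g (Real.arccos s ^ 2))
      (derivHalf g (θ ^ 2) * (2 * θ * -(1 / Real.sin θ))) s := by
    have h1 : HasDerivAt Real.arccos (-(1 / Real.sin θ)) s := by
      have := Real.hasDerivAt_arccos hs2 hs1
      rwa [← Real.sin_arccos, hθs] at this
    have h2 : HasDerivAt (fun s => Real.arccos s ^ 2) (2 * θ * -(1 / Real.sin θ)) s := by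
      convert! h1.pow 2 using 1
      simp [hθs]
    have h3 : HasDerivAt g (derivHalf g (θ ^ 2)) (θ ^ 2) :=
      ((hK.1 (θ ^ 2) (sq_nonneg θ)).hasDerivWithinAt).hasDerivAt (Ici_mem_nhds (by positivity))
    exact h3.comp_of_eq s h2 (by rw [hθs])
  have hproj : HasFDerivAt (fun z : Amb k => inner ℝ z (y : Amb k) * (√(‖z‖ ^ 2))⁻¹)
      (innerSL ℝ (y : Amb k) - s • innerSL ℝ (x : Amb k)) (x : Amb k) := by
    have h1 : HasFDerivAt (fun z : Amb k => inner ℝ z (y : Amb k)) (innerSL ℝ (y : Amb k))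
        (x : Amb k) := by
      have := (innerSL ℝ (y : Amb k)).hasFDerivAt (x := (x : Amb k))
      refine this.congr_of_eventuallyEq (Eventually.of_forall fun z => ?_)
      simp [real_inner_comm]
    have h2 : HasDerivAt (fun r : ℝ => (√r)⁻¹) (-(1 / 2)) (‖(x : Amb k)‖ ^ 2) := by
      have := (Real.hasDerivAt_sqrt (x := ‖(x : Amb k)‖ ^ 2)
        (by rw [norm_coe_sph]; norm_num)).inv (by rw [norm_coe_sph]; norm_num)
      convert! this using 1
      rw [norm_coe_sph]; norm_num
    have h3 := h2.comp_hasFDerivAt (x : Amb k) (hasStrictFDerivAt_norm_sq (x : Amb k)).hasFDerivAt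
    have h4 := h1.mul h3
    convert! h4 using 1
    ext v
    simp [hs]
    ring
  have hcomp := hF.comp_hasFDerivAt_of_eq (x : Amb k) hproj (by simp [hs])
  rw [hasGradientAt_iff_hasFDerivAt]
  have hfun : (fun z : Amb k => potential g (toSphere z) y) =ᶠ[𝓝 (x : Amb k)]
      (fun s => g (Real.arccos s ^ 2)) ∘
        fun z : Amb k => inner ℝ z (y : Amb k) * (√(‖z‖ ^ 2))⁻¹ := by
    filter_upwards [eventually_ne_zero x] with z hz
    simp only [potential, geoDist, Function.comp_apply]
    rw [coe_toSphere hz, inner_smul_left, Real.sqrt_sq (norm_nonneg z), mul_comm]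
    simp
  refine HasFDerivAt.congr_of_eventuallyEq ?_ hfun
  convert! hcomp using 1
  have hG : interactionG g x y = 2 * derivHalf g (θ ^ 2) * (θ / Real.sin θ) := by
    rw [interactionG_eq, ← hθ, Real.sinc_of_ne_zero hθ0.ne', inv_div]
  ext v
  simp only [InnerProductSpace.toDual_apply_apply, hG, inner_smul_left, inner_sub_left,
    conj_trivial, smul_apply, sub_apply,
    innerSL_apply_apply, smul_eq_mul]
  ring

theorem sphereGradient_potential (hK : PotentialHyp g) {x y : Sph k}
    (hxy : geoDist x y < Real.pi) :
    sphereGradient (fun z => potential g z y) x =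
      -(interactionG g x y) •
        ((y : Amb k) - (inner ℝ (x : Amb k) (y : Amb k) : ℝ) • (x : Amb k)) := by
  rcases eq_or_ne x y with rfl | hne
  · rw [sphereGradient, (hasGradientAt_potential_self hK x).gradient, real_inner_self_eq_norm_sq,
      norm_coe_sph]
    simp
  · exact (hasGradientAt_potential_of_ne hK hne hxy).gradient

/-- On the disk the velocity is the average of the kernel `pairVelocity`. -/
theorem velocity_eq_integral_pairVelocity (hK : PotentialHyp g) (hε : 0 < ε)
    (ρ : ℝ≥0 → ProbabilityMeasure (Disk k ε)) (x : Disk k ε) (t : ℝ≥0) :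
    velocity g ρ x t = ∫ y : Disk k ε,
      pairVelocity (couplingOf g (Real.pi - 2 * ε)) (x.1 : Amb k) (y.1 : Amb k)
        ∂(ρ t : Measure (Disk k ε)) := by
  rw [velocity, ← integral_neg]
  refine integral_congr_ae (Eventually.of_forall fun y => ?_)
  have hxy := geoDist_lt_of_disk x y
  have hb : Real.pi - 2 * ε < Real.pi := by linarith
  simp only
  rw [sphereGradient_potential hK (hxy.trans hb),
    pairVelocity_of_norm_eq_one _ (norm_coe_sph _) (norm_coe_sph _), couplingOf_inner hb hxy.le,
    neg_smul, neg_neg]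

end Geometry

/-! ### Weak solutions -/

section WeakSolution

open BoundedContinuousFunction

variable {k : ℕ} {ε : ℝ} {g : ℝ → ℝ}

theorem continuous_coe_disk : Continuous fun x : Disk k ε => (x.1 : Amb k) :=
  continuous_subtype_val.comp continuous_subtype_val

/-- The law `ρ₀` seen as a probability measure on its own support. -/
noncomputable def supportMeasure (ρ₀ : ProbabilityMeasure (Disk k ε)) :
    Measure (ρ₀ : Measure (Disk k ε)).support :=
  (ρ₀ : Measure (Disk k ε)).comap Subtype.val

theorem map_val_supportMeasure (ρ₀ : ProbabilityMeasure (Disk k ε)) :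
    (supportMeasure ρ₀).map Subtype.val = (ρ₀ : Measure (Disk k ε)) := by
  rw [supportMeasure, map_comap_subtype_coe Measure.isClosed_support.measurableSet]
  exact Measure.restrict_eq_self_of_ae_mem Measure.support_mem_ae

instance isProbabilityMeasure_supportMeasure (ρ₀ : ProbabilityMeasure (Disk k ε)) :
    IsProbabilityMeasure (supportMeasure ρ₀) := by
  constructor
  have h := map_val_supportMeasure ρ₀
  have h1 : (supportMeasure ρ₀).map Subtype.val univ = 1 := by rw [h]; exact measure_univ
  rwa [Measure.map_apply measurable_subtype_coe MeasurableSet.univ, preimage_univ] at h1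

/-- The definition of a weak solution with its initial law named. -/
theorem isGlobalWeakSolution_iff {ρ : ℝ≥0 → ProbabilityMeasure (Disk k ε)}
    {ρ₀ : ProbabilityMeasure (Disk k ε)} (h : ρ 0 = ρ₀) :
    IsGlobalWeakSolution g ρ ↔ Continuous ρ ∧
      ∃ Ψ : (ρ₀ : Measure (Disk k ε)).support → ℝ≥0 → Disk k ε,
        IsFlowMap (velocity g ρ) (ρ₀ : Measure (Disk k ε)).support Ψ ∧
        (∀ Φ : (ρ₀ : Measure (Disk k ε)).support → ℝ≥0 → Disk k ε,
          IsFlowMap (velocity g ρ) (ρ₀ : Measure (Disk k ε)).support Φ → Φ = Ψ) ∧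
        ∀ t : ℝ≥0, (ρ t : Measure (Disk k ε)) = (supportMeasure ρ₀).map (fun x => Ψ x t) := by
  subst h
  rfl

/-- The trajectories of a flow map, as curves in the ambient space defined for all real times. -/
noncomputable def ambientFlow {S : Set (Disk k ε)} (Ψ : S → ℝ≥0 → Disk k ε) (x : S) (t : ℝ) :
    Amb k :=
  ((Ψ x t.toNNReal).1 : Amb k)

variable {M L : ℝ}

theorem velocity_eq_meanVelocity (hK : PotentialHyp g) (hε : 0 < ε)
    (hφ : IsCoupling (couplingOf g (Real.pi - 2 * ε)) M L)
    {ρ : ℝ≥0 → ProbabilityMeasure (Disk k ε)} {S : Type*} [MeasurableSpace S] {μ : Measure S}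
    {T : S → Disk k ε} {t : ℝ≥0} (hT : AEMeasurable T μ)
    (hρ : (ρ t : Measure (Disk k ε)) = μ.map T) (x : Disk k ε) :
    velocity g ρ x t = meanVelocity (couplingOf g (Real.pi - 2 * ε)) μ
      (fun y => ((T y).1 : Amb k)) (x.1 : Amb k) := by
  rw [velocity_eq_integral_pairVelocity hK hε, hρ, integral_map hT]
  · rfl
  · exact ((continuous_pairVelocity hφ).comp
      (continuous_const.prodMk continuous_coe_disk)).aestronglyMeasurable

/-- The flow map of any curve of measures is unique, because its velocity field is Lipschitz in
space, uniformly in time. -/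
theorem IsFlowMap.eq (hK : PotentialHyp g) (hε : 0 < ε)
    (hφ : IsCoupling (couplingOf g (Real.pi - 2 * ε)) M L)
    {ρ : ℝ≥0 → ProbabilityMeasure (Disk k ε)} {S : Set (Disk k ε)}
    {Φ Ψ : S → ℝ≥0 → Disk k ε} (hΦ : IsFlowMap (velocity g ρ) S Φ)
    (hΨ : IsFlowMap (velocity g ρ) S Ψ) : Φ = Ψ := by
  have hM := hφ.bound_nonneg
  have hL := hφ.lipschitz_nonneg
  funext x t
  have hder : ∀ (_ : Unit) (s : ℝ), 0 ≤ s → HasDerivWithinAt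
      (fun s => ambientFlow Φ x s - ambientFlow Ψ x s)
      (velocity g ρ (Φ x s.toNNReal) s.toNNReal - velocity g ρ (Ψ x s.toNNReal) s.toNNReal)
      (Ici 0) s := by
    intro _ s hs
    have h1 := (hΦ x).2 s.toNNReal
    have h2 := (hΨ x).2 s.toNNReal
    rw [Real.coe_toNNReal s hs] at h1 h2
    exact h1.sub h2
  have key := eq_zero_of_norm_deriv_le_mul_sup (ι := Unit)
    (u := fun _ s => ambientFlow Φ x s - ambientFlow Ψ x s) (L := 4 * (L + M)) (M := 2)
    (by positivity) hder ?_ ?_ ?_ () t.2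
  · apply Subtype.ext
    apply Subtype.ext
    have h := sub_eq_zero.1 key
    simpa [ambientFlow] using h
  · intro _
    simp [ambientFlow, (hΦ x).1, (hΨ x).1]
  · intro _ s _
    refine (norm_sub_le _ _).trans ?_
    rw [ambientFlow, ambientFlow, norm_coe_sph, norm_coe_sph]
    norm_num
  · intro s hs c _ hc _
    have hid : (ρ s.toNNReal : Measure (Disk k ε)) =
        (ρ s.toNNReal : Measure (Disk k ε)).map id := Measure.map_id.symm
    rw [velocity_eq_meanVelocity hK hε hφ aemeasurable_id hid,
      velocity_eq_meanVelocity hK hε hφ aemeasurable_id hid]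
    have hval : AEStronglyMeasurable (fun y : Disk k ε => ((id y).1 : Amb k))
        (ρ s.toNNReal : Measure (Disk k ε)) := continuous_coe_disk.aestronglyMeasurable
    refine (norm_meanVelocity_sub_le hφ hval hval (c := 0) (fun y => by simp) _ _).trans ?_
    rw [add_zero]
    exact mul_le_mul_of_nonneg_left (hc ()) (by positivity)

/-- The flow of a weak solution solves the mean-field equation. Its measurability in the label is
forced: the push-forward by a map that is not almost everywhere measurable is zero. -/
theorem IsFlowMap.isMeanFieldFlow (hK : PotentialHyp g) (hε : 0 < ε)
    (hφ : IsCoupling (couplingOf g (Real.pi - 2 * ε)) M L)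
    {ρ : ℝ≥0 → ProbabilityMeasure (Disk k ε)} {S : Set (Disk k ε)} {μ : Measure S}
    {Ψ : S → ℝ≥0 → Disk k ε} (hΨ : IsFlowMap (velocity g ρ) S Ψ)
    (hρ : ∀ t, (ρ t : Measure (Disk k ε)) = μ.map (fun x => Ψ x t)) :
    IsMeanFieldFlow (couplingOf g (Real.pi - 2 * ε)) μ (ambientFlow Ψ) := by
  have hmeas : ∀ t, AEMeasurable (fun x => Ψ x t) μ := by
    intro t
    by_contra hn
    have h := hρ t
    rw [Measure.map_of_not_aemeasurable hn] at h
    exact IsProbabilityMeasure.ne_zero (ρ t : Measure (Disk k ε)) h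
  refine ⟨fun t _ => continuous_coe_disk.comp_aestronglyMeasurable
    (hmeas t.toNNReal).aestronglyMeasurable, fun x t ht => ?_⟩
  have h := (hΨ x).2 t.toNNReal
  rw [velocity_eq_meanVelocity hK hε hφ (hmeas _) (hρ _), Real.coe_toNNReal t ht] at h
  exact h

theorem isGlobalWeakSolution_unique (hK : PotentialHyp g) (hε : 0 < ε)
    (hφ : IsCoupling (couplingOf g (Real.pi - 2 * ε)) M L)
    {ρ σ : ℝ≥0 → ProbabilityMeasure (Disk k ε)} (hρ : IsGlobalWeakSolution g ρ)
    (hσ : IsGlobalWeakSolution g σ) (h0 : σ 0 = ρ 0) : σ = ρ := by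
  obtain ⟨-, Ψ, hΨ, -, hΨρ⟩ := (isGlobalWeakSolution_iff rfl).1 hρ
  obtain ⟨-, Φ, hΦ, -, hΦσ⟩ := (isGlobalWeakSolution_iff h0).1 hσ
  have heq : ∀ x t, Φ x t = Ψ x t := by
    intro x t
    have h := IsMeanFieldFlow.unique hφ (hΦ.isMeanFieldFlow hK hε hφ hΦσ)
      (hΨ.isMeanFieldFlow hK hε hφ hΨρ) (fun x t _ => norm_coe_sph _) (fun x t _ => norm_coe_sph _)
      (fun x => by simp [ambientFlow, (hΦ x).1, (hΨ x).1]) x t.2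
    apply Subtype.ext
    apply Subtype.ext
    simpa [ambientFlow] using h
  funext t
  apply Subtype.ext
  change (σ t : Measure (Disk k ε)) = (ρ t : Measure (Disk k ε))
  refine (hΦσ t).trans (Eq.trans ?_ (hΨρ t).symm)
  simp only [heq]

theorem geoDist_northPole_le_iff {r : ℝ} (hr : 0 ≤ r) (hrπ : r ≤ Real.pi) (x : Sph k) :
    geoDist x (northPole k) ≤ r ↔
      Real.cos r ≤ inner ℝ (northPole k : Amb k) (x : Amb k) := by
  rw [real_inner_comm, ← cos_geoDist]
  exact (Real.strictAntiOn_cos.le_iff_ge ⟨hr, hrπ⟩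
    ⟨geoDist_nonneg _ _, Real.arccos_le_pi _⟩).symm

/-- The mean-field flow started from the support of `ρ₀` stays in the closed disk of radius `r`.
Its derivative exists uniformly in the label, so that the mean of the positions is differentiable
too. -/
theorem exists_flow (hε : 0 < ε) (hφ : IsCoupling (couplingOf g (Real.pi - 2 * ε)) M L) {r : ℝ}
    (hr : 0 < r) (hr' : r < Real.pi / 2 - ε) (ρ₀ : ProbabilityMeasure (Disk k ε))
    (hρ₀ : ∀ x ∈ (ρ₀ : Measure (Disk k ε)).support, geoDist x.1 (northPole k) ≤ r) :
    ∃ Ψ : (ρ₀ : Measure (Disk k ε)).support → ℝ≥0 → Disk k ε,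
      (∀ x, Ψ x 0 = x) ∧ (∀ t, Continuous fun x => Ψ x t) ∧
      IsMeanFieldFlow (couplingOf g (Real.pi - 2 * ε)) (supportMeasure ρ₀) (ambientFlow Ψ) ∧
      (∀ x t, geoDist (Ψ x t).1 (northPole k) ≤ r) ∧
      ∀ t, 0 ≤ t → HasDerivWithinAt (fun t => ∫ x, ambientFlow Ψ x t ∂(supportMeasure ρ₀))
        (∫ x, meanVelocity (couplingOf g (Real.pi - 2 * ε)) (supportMeasure ρ₀)
          (fun y => ambientFlow Ψ y t) (ambientFlow Ψ x t) ∂(supportMeasure ρ₀)) (Ici 0) t := by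
  set μ := supportMeasure ρ₀
  have hrπ : r ≤ Real.pi := by linarith [Real.pi_pos]
  have hcont : Continuous fun x : (ρ₀ : Measure (Disk k ε)).support => (x.1.1 : Amb k) :=
    continuous_coe_disk.comp continuous_subtype_val
  obtain ⟨α, hα0, hα⟩ := exists_meanField_flow (μ := μ) hφ
    (BoundedContinuousFunction.ofNormedAddCommGroup _ hcont 1 fun x => (norm_coe_sph _).le)
  have hα0' : ∀ x, α 0 x = (x.1.1 : Amb k) := fun x => by rw [hα0]; rfl
  have hflow : IsMeanFieldFlow (couplingOf g (Real.pi - 2 * ε)) μ (fun x t => α t x) :=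
    ⟨fun t _ => (α t).continuous.aestronglyMeasurable,
      fun x t ht => hasDerivWithinAt_bcf_apply (hα t ht) x⟩
  have hnorm0 : ∀ x, ‖α 0 x‖ = 1 := fun x => by rw [hα0']; exact norm_coe_sph _
  have hnorm : ∀ x t, 0 ≤ t → ‖α t x‖ = 1 := fun x t ht =>
    hflow.norm_eq_one hφ (hnorm0 x) ht
  have hcap : ∀ x t, 0 ≤ t → Real.cos r ≤ inner ℝ (northPole k : Amb k) (α t x) := by
    intro x t ht
    refine hflow.le_inner hφ hnorm0 (norm_coe_sph _) ?_ (fun y => ?_) x ht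
    · exact Real.cos_nonneg_of_mem_Icc ⟨by linarith [Real.pi_pos], by linarith⟩
    · simp only [hα0']
      exact (geoDist_northPole_le_iff hr.le hrπ _).1 (hρ₀ y.1 y.2)
  let Ψs : (ρ₀ : Measure (Disk k ε)).support → ℝ≥0 → Sph k := fun x t =>
    ⟨α t x, by rw [mem_sphere_zero_iff_norm]; exact hnorm x t t.2⟩
  have hΨs : ∀ x t, geoDist (Ψs x t) (northPole k) ≤ r := fun x t =>
    (geoDist_northPole_le_iff hr.le hrπ _).2 (hcap x t t.2)
  let Ψ : (ρ₀ : Measure (Disk k ε)).support → ℝ≥0 → Disk k ε := fun x t =>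
    ⟨Ψs x t, (hΨs x t).trans_lt hr'⟩
  have hΨα : ∀ x t, 0 ≤ t → ambientFlow Ψ x t = α t x := fun x t ht => by
    change α t.toNNReal x = α t x
    rw [Real.coe_toNNReal t ht]
  refine ⟨Ψ, fun x => ?_, fun t => ?_, ⟨fun t ht => ?_, fun x t ht => ?_⟩, hΨs, fun t ht => ?_⟩
  · exact Subtype.ext (Subtype.ext (hα0' x))
  · exact Continuous.subtype_mk (Continuous.subtype_mk (α t).continuous _) _
  · simp only [hΨα _ t ht]
    exact hflow.aestronglyMeasurable t ht
  · simp only [hΨα _ t ht]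
    exact (hflow.hasDerivWithinAt x t ht).congr (fun s hs => hΨα x s hs) (hΨα x t ht)
  · simp only [hΨα _ t ht]
    -- Integration against `μ` is a bounded linear functional on bounded continuous functions.
    let I : ((ρ₀ : Measure (Disk k ε)).support →ᵇ Amb k) →L[ℝ] Amb k :=
      LinearMap.mkContinuous
        { toFun := fun u => ∫ x, u x ∂μ
          map_add' := fun u v => integral_add (u.integrable μ) (v.integrable μ)
          map_smul' := fun a u => integral_smul a u } 1
        (fun u => by rw [one_mul]; exact u.norm_integral_le_norm μ)
    have h := I.hasFDerivAt.comp_hasDerivWithinAt t (hα t ht)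
    refine HasDerivWithinAt.congr (f := I ∘ α) h (fun s hs => ?_) ?_
    · exact integral_congr_ae (Eventually.of_forall fun x => hΨα x s hs)
    · exact integral_congr_ae (Eventually.of_forall fun x => hΨα x t ht)

/-- The push-forward of the initial law by a mean-field flow is a weak solution. -/
theorem isGlobalWeakSolution_of_flow (hK : PotentialHyp g) (hε : 0 < ε)
    (hφ : IsCoupling (couplingOf g (Real.pi - 2 * ε)) M L)
    {ρ₀ : ProbabilityMeasure (Disk k ε)}
    {Ψ : (ρ₀ : Measure (Disk k ε)).support → ℝ≥0 → Disk k ε} (hΨ0 : ∀ x, Ψ x 0 = x)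
    (hΨc : ∀ t, Continuous fun x => Ψ x t)
    (hΨ : IsMeanFieldFlow (couplingOf g (Real.pi - 2 * ε)) (supportMeasure ρ₀) (ambientFlow Ψ))
    {ρ : ℝ≥0 → ProbabilityMeasure (Disk k ε)}
    (hρ : ∀ t, (ρ t : Measure (Disk k ε)) = (supportMeasure ρ₀).map (fun x => Ψ x t)) :
    IsGlobalWeakSolution g ρ ∧ ρ 0 = ρ₀ := by
  have hflow : IsFlowMap (velocity g ρ) (ρ₀ : Measure (Disk k ε)).support Ψ := by
    refine fun x => ⟨hΨ0 x, fun t => ?_⟩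
    rw [velocity_eq_meanVelocity hK hε hφ (hΨc t).aemeasurable (hρ t)]
    have h := hΨ.hasDerivWithinAt x t t.2
    simp only [ambientFlow, Real.toNNReal_coe] at h
    exact h
  have h0 : ρ 0 = ρ₀ := by
    apply Subtype.ext
    change (ρ 0 : Measure (Disk k ε)) = ρ₀
    refine (hρ 0).trans (Eq.trans ?_ (map_val_supportMeasure ρ₀))
    simp only [hΨ0]
  refine ⟨(isGlobalWeakSolution_iff h0).2 ⟨?_, Ψ, hflow, fun Φ hΦ => hΦ.eq hK hε hφ hflow, hρ⟩, h0⟩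
  rw [continuous_iff_continuousAt]
  intro t₀
  refine ProbabilityMeasure.tendsto_iff_forall_integral_tendsto.2 fun f => ?_
  have hint : ∀ t, ∫ y, f y ∂(ρ t : Measure (Disk k ε)) =
      ∫ x, f (Ψ x t) ∂(supportMeasure ρ₀) := fun t => by
    rw [hρ, integral_map (hΨc t).aemeasurable f.continuous.aestronglyMeasurable]
  simp only [hint]
  refine Continuous.tendsto (f := fun t => ∫ x, f (Ψ x t) ∂(supportMeasure ρ₀))
    (continuous_of_dominated (bound := fun _ => ‖f‖) (fun t => ?_) (fun t => ?_)
      (integrable_const _) (Eventually.of_forall fun x => ?_)) t₀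
  · exact (f.continuous.comp (hΨc t)).aestronglyMeasurable
  · exact Eventually.of_forall fun x => f.norm_coe_le_norm _
  · refine f.continuous.comp (Continuous.subtype_mk (Continuous.subtype_mk ?_ _) _)
    have h1 : ContinuousOn (ambientFlow Ψ x) (Ici 0) := fun t ht =>
      (hΨ.hasDerivWithinAt x t ht).continuousWithinAt
    have h2 := h1.comp_continuous NNReal.continuous_coe (fun t => t.2)
    simpa [ambientFlow, Function.comp_def] using h2

end WeakSolution

/-! ### Convergence in Wasserstein distance -/

section Wasserstein

variable {k : ℕ} {ε : ℝ}

/-- The distance to a Dirac mass in terms of the mean position: the geodesic distance is at most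
`π / 2` times the chord `ℓ`, and `ℓ ≤ δ + ℓ ^ 2 / (4 δ)`, where `ℓ ^ 2 = 2 - 2 (x · p)`. -/
theorem W1_dirac_le (ν : Measure (Disk k ε)) [IsProbabilityMeasure ν] (p : Disk k ε) {δ : ℝ}
    (hδ : 0 < δ) :
    W1 ν (Measure.dirac p) ≤ ENNReal.ofReal (Real.pi / 2 *
      (δ + (1 - inner ℝ (p.1 : Amb k) (∫ y, (y.1 : Amb k) ∂ν)) / (2 * δ))) := by
  have hpair : Continuous fun y : Disk k ε => (y, p) := continuous_id.prodMk continuous_const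
  have hplan : W1 ν (Measure.dirac p) ≤ ∫⁻ y, ENNReal.ofReal (geoDist y.1 p.1) ∂ν := by
    have hfst : (ν.map fun y => (y, p)).map Prod.fst = ν := by
      rw [Measure.map_map measurable_fst hpair.measurable]
      exact Measure.map_id
    have hsnd : (ν.map fun y => (y, p)).map Prod.snd = Measure.dirac p := by
      rw [Measure.map_map measurable_snd hpair.measurable]
      change ν.map (fun _ => p) = _
      rw [Measure.map_const, measure_univ, one_smul]
    refine (iInf₂_le (ν.map fun y => (y, p)) ⟨hfst, hsnd⟩).trans_eq ?_
    · refine lintegral_map ?_ hpair.measurable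
      have h1 : Continuous fun z : Disk k ε × Disk k ε => geoDist z.1.1 z.2.1 :=
        Real.continuous_arccos.comp ((continuous_coe_disk.comp continuous_fst).inner
          (continuous_coe_disk.comp continuous_snd))
      exact h1.measurable.ennreal_ofReal
  have hval : Integrable (fun y : Disk k ε => (y.1 : Amb k)) ν :=
    Integrable.of_bound continuous_coe_disk.aestronglyMeasurable 1
      (Eventually.of_forall fun y => (norm_coe_sph _).le)
  have hinner : Integrable (fun y : Disk k ε => inner ℝ (p.1 : Amb k) (y.1 : Amb k)) ν :=
    hval.const_inner _
  set h : Disk k ε → ℝ := fun y =>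
    Real.pi / 2 * (δ + (1 - inner ℝ (p.1 : Amb k) (y.1 : Amb k)) / (2 * δ))
  have hquot : Integrable (fun y : Disk k ε =>
      (1 - inner ℝ (p.1 : Amb k) (y.1 : Amb k)) / (2 * δ)) ν :=
    ((integrable_const 1).sub hinner).div_const (2 * δ)
  have hint : Integrable h ν := ((integrable_const δ).add hquot).const_mul _
  have hle : ∀ y : Disk k ε, geoDist y.1 p.1 ≤ h y := by
    intro y
    refine (geoDist_le_mul_norm_sub y.1 p.1).trans ?_
    have hπ := Real.pi_pos
    refine mul_le_mul_of_nonneg_left ?_ (by positivity)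
    set ℓ := ‖(y.1 : Amb k) - p.1‖ with hℓ
    have h1 : ℓ ^ 2 = 2 - 2 * inner ℝ (p.1 : Amb k) (y.1 : Amb k) := by
      rw [hℓ, norm_sub_sq_real, norm_coe_sph, norm_coe_sph, real_inner_comm]; ring
    have h2 : (1 - inner ℝ (p.1 : Amb k) (y.1 : Amb k)) = ℓ ^ 2 / 2 := by linarith
    rw [h2, ← sub_nonneg]
    have h3 : δ + ℓ ^ 2 / 2 / (2 * δ) - ℓ = (2 * δ - ℓ) ^ 2 / (4 * δ) := by field_simp; ring
    rw [h3]
    positivity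
  refine hplan.trans ((lintegral_mono fun y => ENNReal.ofReal_le_ofReal (hle y)).trans_eq ?_)
  rw [← ofReal_integral_eq_lintegral_ofReal hint
    (Eventually.of_forall fun y => (geoDist_nonneg _ _).trans (hle y))]
  congr 1
  rw [integral_const_mul, integral_add (integrable_const _) hquot, integral_div,
    integral_sub (integrable_const _) hinner, integral_inner hval]
  simp

theorem tendsto_W1_dirac {ρ : ℝ≥0 → ProbabilityMeasure (Disk k ε)} {p : Disk k ε}
    (hp : Tendsto (fun t => ∫ y, (y.1 : Amb k) ∂(ρ t : Measure (Disk k ε))) atTop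
      (𝓝 (p.1 : Amb k))) :
    Tendsto (fun t => W1 (ρ t : Measure (Disk k ε)) (Measure.dirac p)) atTop (𝓝 0) := by
  rw [ENNReal.tendsto_nhds_zero]
  intro η hη
  obtain ⟨e, he0, he⟩ := ENNReal.lt_iff_exists_nnreal_btwn.1 hη
  have he0' : (0 : ℝ) < e := by exact_mod_cast he0
  have hπ := Real.pi_pos
  set δ := (e : ℝ) / Real.pi with hδ
  have hδ0 : 0 < δ := by positivity
  have hlim : Tendsto (fun t => Real.pi / 2 * (δ + (1 - inner ℝ (p.1 : Amb k)
      (∫ y, (y.1 : Amb k) ∂(ρ t : Measure (Disk k ε)))) / (2 * δ))) atTop (𝓝 ((e : ℝ) / 2)) := by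
    have h1 := (((hp.inner (tendsto_const_nhds (x := (p.1 : Amb k)))).const_sub
      (1 : ℝ)).div_const (2 * δ)).const_add δ |>.const_mul (Real.pi / 2)
    rw [real_inner_self_eq_norm_sq, norm_coe_sph] at h1
    have h2 : Real.pi / 2 * (δ + (1 - 1 ^ 2) / (2 * δ)) = (e : ℝ) / 2 := by
      rw [hδ]; field_simp; ring
    rw [h2] at h1
    simpa only [real_inner_comm] using h1
  filter_upwards [hlim.eventually_lt_const (half_lt_self he0')] with t ht
  refine (W1_dirac_le _ p hδ0).trans (le_trans ?_ he.le)
  rw [← ENNReal.ofReal_coe_nnreal]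
  exact ENNReal.ofReal_le_ofReal ht.le

end Wasserstein

end SphereConsensus

theorem mainTheorem2 (k : ℕ) (ε r : ℝ) (hε : 0 < ε) (hε' : ε < Real.pi / 2)
    (hr : 0 < r) (hr' : r < Real.pi / 2 - ε)
    (g : ℝ → ℝ) (hK : PotentialHyp g)
    (hg_nonneg : ∀ s : ℝ, 0 ≤ s → 0 ≤ derivHalf g s)
    (hg_C1 : ContDiffOn ℝ 1 (derivHalf g) (Icc 0 (4 * r ^ 2)))
    (hG_pos : ∃ C : ℝ, 0 < C ∧ ∀ x y : Disk k ε, C ≤ interactionG g x.1 y.1)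
    (hG_mono : ∀ x₁ y₁ x₂ y₂ : Disk k ε,
      geoDist x₂.1 y₂.1 ≤ geoDist x₁.1 y₁.1 → interactionG g x₂.1 y₂.1 ≤ interactionG g x₁.1 y₁.1)
    (ρ₀ : ProbabilityMeasure (Disk k ε))
    (hρ₀ : ∀ x ∈ (ρ₀ : Measure (Disk k ε)).support, geoDist x.1 (northPole k) ≤ r) :
    ∃ ρ : ℝ≥0 → ProbabilityMeasure (Disk k ε),
      (IsGlobalWeakSolution g ρ ∧ ρ 0 = ρ₀) ∧
      (∀ σ : ℝ≥0 → ProbabilityMeasure (Disk k ε),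
        IsGlobalWeakSolution g σ ∧ σ 0 = ρ₀ → σ = ρ) ∧
      ∃ p : Disk k ε, geoDist p.1 (northPole k) ≤ r ∧
        Tendsto (fun t : ℝ≥0 => W1 (ρ t : Measure (Disk k ε)) (Measure.dirac p)) atTop (𝓝 0) := by
  have hb : Real.pi - 2 * ε < Real.pi := by linarith
  obtain ⟨M, L, hφ⟩ := exists_isCoupling_couplingOf hK hg_nonneg
    (b := Real.pi - 2 * ε) (by linarith) hb
  obtain ⟨C, hC, hGC⟩ := hG_pos
  obtain ⟨Ψ, hΨ0, hΨc, hΨ, hΨr, hmean⟩ := exists_flow hε hφ hr hr' ρ₀ hρ₀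
  let ρ : ℝ≥0 → ProbabilityMeasure (Disk k ε) := fun t =>
    ⟨(supportMeasure ρ₀).map (fun x => Ψ x t),
      Measure.isProbabilityMeasure_map (hΨc t).aemeasurable⟩
  have hsol := isGlobalWeakSolution_of_flow hK hε hφ hΨ0 hΨc hΨ (ρ := ρ) (fun t => rfl)
  refine ⟨ρ, hsol, fun σ hσ => isGlobalWeakSolution_unique hK hε hφ hsol.1 hσ.1
    (hσ.2.trans hsol.2.symm), ?_⟩
  set μ := supportMeasure ρ₀
  have hrπ : r ≤ Real.pi := by linarith [Real.pi_pos]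
  have hcosr : 0 < Real.cos r :=
    Real.cos_pos_of_mem_Ioo ⟨by linarith [Real.pi_pos], by linarith⟩
  have hcap : ∀ x t, Real.cos r ≤ inner ℝ (northPole k : Amb k) (ambientFlow Ψ x t) := fun x t =>
    (geoDist_northPole_le_iff hr.le hrπ _).1 (hΨr x _)
  have hstrength : ∀ t x y, C ≤ couplingOf g (Real.pi - 2 * ε)
      (inner ℝ (ambientFlow Ψ x t) (ambientFlow Ψ y t)) := fun t x y => by
    rw [ambientFlow, ambientFlow, couplingOf_inner hb (geoDist_lt_of_disk _ _).le]
    exact hGC _ _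
  have hrates := fun (t : ℝ) (ht : 0 ≤ t) =>
    norm_integral_meanVelocity_le_and_le_inner hφ (hΨ.aestronglyMeasurable t ht)
      (fun x => norm_coe_sph _) hcosr.le (hstrength t) (fun x => hcap x t)
  have hint : ∀ t, 0 ≤ t → Integrable (fun x => ambientFlow Ψ x t) μ := fun t ht =>
    Integrable.of_bound (hΨ.aestronglyMeasurable t ht) 1
      (Eventually.of_forall fun x => (norm_coe_sph _).le)
  obtain ⟨p, hp1, hp⟩ := exists_tendsto_of_norm_deriv_le (mul_pos hC hcosr) hφ.bound_nonneg hmean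
    (fun t _ => by
      have h1 : ∀ x, ‖ambientFlow Ψ x t‖ ≤ 1 := fun x => (norm_coe_sph _).le
      simpa using norm_integral_le_of_norm_le_const (μ := μ) (Eventually.of_forall h1))
    (fun t ht => (hrates t ht).1) (fun t ht => (hrates t ht).2)
  have hpcap : Real.cos r ≤ inner ℝ (northPole k : Amb k) p := by
    refine ge_of_tendsto' ((tendsto_const_nhds (x := (northPole k : Amb k))).inner hp) fun t => ?_
    rw [← integral_inner (hint t t.2)]
    have h := integral_mono (integrable_const (Real.cos r)) ((hint t t.2).const_inner
      (northPole k : Amb k)) (fun x => hcap x t)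
    simpa using h
  let ps : Sph k := ⟨p, by rw [mem_sphere_zero_iff_norm]; exact hp1⟩
  have hps : geoDist ps (northPole k) ≤ r := (geoDist_northPole_le_iff hr.le hrπ ps).2 hpcap
  refine ⟨⟨ps, hps.trans_lt hr'⟩, hps, tendsto_W1_dirac ?_⟩
  refine hp.congr fun t => ?_
  change _ = ∫ y, (y.1 : Amb k) ∂(μ.map (fun x => Ψ x t))
  rw [integral_map (hΨc t).aemeasurable continuous_coe_disk.aestronglyMeasurable]
  simp only [ambientFlow, Real.toNNReal_coe]
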